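/- Let $t\ge 1$ be a perfect square and let $n\ge 1$ be divisible by $t$. A synchronous system of $t$ processes $0,\dots,t-1$ has to perform $n$ units of work $1,\dots,n$; subchunk $s$ ($1\le s\le t$) consists of the units $(s-1)\frac nt+1,\dots,s\frac nt$. In each round $1,2,\dots$ a process performs at most one unit of work or makes at most one broadcast; a message sent in a round is received at the end of that round. Any set of processes may crash, at any times; a process that crashes does nothing afterwards, and if it crashes during a broadcast, an arbitrary subset of the recipients receives the message. A process is *retired* if it has crashed or terminated. Let $g_j=\lceil (j+1)/\sqrt t\,\rceil$ be the group of process $j$, $\bar\jmath=j \bmod \sqrt t$, and $$PTO=\tfrac nt+2,\qquad GTO(i)=\tfrac n{\sqrt t}+3\sqrt t+(\sqrt t-\bar\imath-1)\,PTO+1,$$ $$DD_{\mathcal B}(j,i)=\begin{cases}GTO(i)+(g_j-g_i-1)\,GTO(0)& g_j\ne g_i,\\ PTO & g_j=g_i.\end{cases}$$ Ordinary messages have the form $(c)$ or $(c,g)$; there are also "go ahead" messages. *Operations of an active process $j$.* Partialcheckpoint$(c)$: broadcast $(c)$ to the remainder of its group (the members of $g_j$ with number $>j$). Fullcheckpoint$(c,l)$: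 for $g=l,\dots,\sqrt t$, broadcast $(c,g)$ to group $g$, then $(c,g)$ to the remainder of $g_j$. Every broadcast takes one round, even if it has no recipients. *DoWork.* Let the last ordinary message received by $j$ be from process $k$. If it is $(c,g)$ with $g_k\neq g_j$, do Partialcheckpoint$(c)$ and Fullcheckpoint$(c,g_j+1)$. If it is $(c,g)$ with $g_k=g_j$, broadcast $(c,g)$ to the remainder of $g_j$ and do Fullcheckpoint$(c,g+1)$. If it is $(c)$, do Partialcheckpoint$(c)$ and, if $\sqrt t\mid c$, Fullcheckpoint$(c,g_j+1)$. Then for $s=c+1,\dots,t$: perform subchunk $s$ one unit per round, do Partialcheckpoint$(s)$ and, if $\sqrt t\mid s$, Fullcheckpoint$(s,g_j+1)$. Then terminate. *Protocol $\mathcal B$.* By convention every process $j\neq 0$ receives from process $0$ in round $0$ an ordinary message $(0,g_j)$, which is not counted. Process $0$ is active from the start and begins with subchunk $1$ in round $1$. A process $j$ that has not become active terminates when it receives $(t)$ or $(t,g_j)$. Otherwise, let its last ordinary message have come from process $i$ at round $r'$, and let $a=(g_j-1)\sqrt t$ if $g_i\ne g_j$ and $a=i+1$ if $g_i=g_j$.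 It sends a "go ahead" message to process $p$ at round $r'+DD_{\mathcal B}(j,i)+(p-a)\,PTO$, for $p=a,\dots,j-1$, and becomes active, executing DoWork, at round $r'+DD_{\mathcal B}(j,i)+(j-a)\,PTO$, unless it receives an ordinary message before (then all of this starts afresh with the new message) or a "go ahead" message before (then it becomes active, with its first operation in the next round). If several ordinary messages arrive in the same round, the one from the lowest-numbered sender counts. Messages that reach an active process are ignored. **Theorem.** In every execution of Protocol $\mathcal B$: (a) at most $3n$ units of work are performed in total by the processes, counted with multiplicity; (b) at most $10\,t\sqrt t$ messages are sent in total, "go ahead" messages included (a broadcast to $m$ recipients counts as $m$ messages, also if the sender crashes during it); (c) by (the end of) round $3n+8t$ all processes have retired; (d) before the round in which a process $i$ becomes active, all processes $<i$ have retired. -/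

import Mathlib

/-!
Protocol B: `t` synchronous processes, numbered `0, …, t - 1` and subject to crash failures, perform
`n` units of work, numbered `1, …, n`.  Throughout, `t` is meant to be a positive perfect square
that divides `n`, and `n` to be positive, so that `Nat.sqrt t`, `n / Nat.sqrt t` and `n / t` are the
exact values of `√t`, `n / √t` and `n / t`.
-/

namespace ProtocolB

/-! ### Groups and deadlines -/

/-- The group `g_i = ⌈(i + 1) / √t⌉` of process `i`; the groups are numbered `1, …, √t`. -/
def group (t i : ℕ) : ℕ := i / Nat.sqrt t + 1

/-- The position `i mod √t` of process `i` in its group. -/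
def pos (t i : ℕ) : ℕ := i % Nat.sqrt t

/-- The process time out. -/
def PTO (n t : ℕ) : ℕ := n / t + 2

/-- The group time out. -/
def GTO (n t i : ℕ) : ℕ :=
  n / Nat.sqrt t + 3 * Nat.sqrt t + (Nat.sqrt t - pos t i - 1) * PTO n t + 1

/-- The deadline function: how long after its last ordinary message, received from process `i`,
process `j > i` becomes preactive. -/
def DD (n t j i : ℕ) : ℕ :=
  if group t j ≠ group t i then GTO n t i + (group t j - group t i - 1) * GTO n t 0 else PTO n t

/-! ### Messages and elementary operations -/

/-- Ordinary messages: `(c)`, written `subchunk c`, and `(c, g)`, written `chunk c g`. -/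
inductive Ordinary where
  | subchunk (c : ℕ)
  | chunk (c g : ℕ)
  deriving DecidableEq

/-- A message is ordinary or a "go ahead" message. -/
inductive Message where
  | ordinary (m : Ordinary)
  | goAhead
  deriving DecidableEq

/-- What a process can do in one round: perform unit `u` of work, or broadcast a message. -/
inductive Op (t : ℕ) where
  | work (u : ℕ)
  | send (m : Message) (recipients : Finset (Fin t))

/-- All processes of group `g`. -/
def members (t g : ℕ) : Finset (Fin t) := {q | group t q = g}

/-- The remainder `j + 1, …, g_j √t - 1` of the group of `j`. -/
def remainder {t : ℕ} (j : Fin t) : Finset (Fin t) := {q | j < q ∧ group t q = group t j}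

/-! ### The code of an active process, as the list of its operations, one for each round -/

/-- Inform the remainder of the own group that subchunk `c` has been performed. -/
def partialCheckpoint {t : ℕ} (j : Fin t) (c : ℕ) : List (Op t) :=
  [.send (.ordinary (.subchunk c)) (remainder j)]

/-- For `g = l, …, √t`: inform group `g`, and then inform the remainder of the own group that group
`g` has been informed. -/
def fullCheckpoint {t : ℕ} (j : Fin t) (c l : ℕ) : List (Op t) :=
  (List.range' l (Nat.sqrt t + 1 - l)).flatMap fun g =>
    [.send (.ordinary (.chunk c g)) (members t g), .send (.ordinary (.chunk c g)) (remainder j)]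

/-- Perform subchunk `s`, which consists of the units `(s - 1) n/t + 1, …, s n/t`. -/
def performSubchunk (n t s : ℕ) : List (Op t) :=
  (List.range' ((s - 1) * (n / t) + 1) (n / t)).map .work

/-- For `s = c + 1, …, t`: perform subchunk `s`, do a partial checkpoint, and, if `s` is a multiple
of `√t`, a full checkpoint. -/
def continueWork (n : ℕ) {t : ℕ} (j : Fin t) (c : ℕ) : List (Op t) :=
  (List.range' (c + 1) (t - c)).flatMap fun s =>
    performSubchunk n t s ++ partialCheckpoint j s ++
      (if Nat.sqrt t ∣ s then fullCheckpoint j s (group t j + 1) else [])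

/-- The whole activity of process `j` when it becomes active and the last ordinary message that it
received came from process `k`.  It terminates after the last operation. -/
def doWork (n : ℕ) {t : ℕ} (j k : Fin t) : Ordinary → List (Op t)
  | .chunk c g =>
      (if group t k ≠ group t j then
        partialCheckpoint j c ++ fullCheckpoint j c (group t j + 1)
      else
        .send (.ordinary (.chunk c g)) (remainder j) :: fullCheckpoint j c (g + 1)) ++
      continueWork n j c
  | .subchunk c =>
      partialCheckpoint j c ++
      (if Nat.sqrt t ∣ c then fullCheckpoint j c (group t j + 1) else []) ++
      continueWork n j c

/-! ### Local states -/

/-- The state of a process. A process is `passive sender msg r'` if it has not become active yet and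
the last ordinary message that it received is `msg`, from process `sender`, at round `r'` (this
includes the preactive phase, which is determined by these data and the current round).  It is
`active todo` if it still has to execute the nonempty list `todo`. -/
inductive State (t : ℕ) where
  | passive (sender : Fin t) (msg : Ordinary) (r' : ℕ)
  | active (todo : List (Op t))
  | terminated
  | crashed

/-- A process is retired if it has crashed or terminated. -/
def State.Retired {t : ℕ} : State t → Prop
  | .terminated => True
  | .crashed => True
  | _ => False

def State.IsActive {t : ℕ} : State t → Prop
  | .active _ => True
  | _ => False

/-- The first process that `j` polls in its preactive phase, where `i` is the sender of the last
ordinary message that `j` received: the first process of the group of `j` if `i` is in another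
group, and `i + 1` otherwise. -/
def firstPolled (t j i : ℕ) : ℕ :=
  if group t i ≠ group t j then (group t j - 1) * Nat.sqrt t else i + 1

/-- Time out at the beginning of round `r`: a passive process `j` that has spent `PTO` rounds on
each of the processes `firstPolled, …, j - 1` becomes active. -/
def wake (n : ℕ) {t : ℕ} (r : ℕ) (j : Fin t) : State t → State t
  | .passive i m r' =>
      if r = r' + DD n t j i + ((j : ℕ) - firstPolled t j i) * PTO n t then
        .active (doWork n j i m)
      else .passive i m r'
  | σ => σ

/-- The operation of process `j` in round `r`.  An active process executes its next operation.  A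
passive process does nothing before round `r' + DD`; then it is preactive and sends a "go ahead"
message to each of the processes `firstPolled, …, j - 1`, one every `PTO` rounds. -/
def operation (n : ℕ) {t : ℕ} (r : ℕ) (j : Fin t) : State t → Option (Op t)
  | .active (o :: _) => some o
  | .passive i _ r' =>
      if r' + DD n t j i ≤ r ∧ PTO n t ∣ r - (r' + DD n t j i) then
        let p := firstPolled t j i + (r - (r' + DD n t j i)) / PTO n t
        if h : p < j then some (.send .goAhead {⟨p, h.trans j.isLt⟩}) else none
      else none
  | _ => none

/-- The messages `(t)` and `(t, g_j)`, on which process `j` terminates before becoming active. -/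
def IsFinal {t : ℕ} (j : Fin t) (m : Ordinary) : Prop :=
  m = .subchunk t ∨ m = .chunk t (group t j)

instance {t : ℕ} (j : Fin t) (m : Ordinary) : Decidable (IsFinal j m) :=
  inferInstanceAs (Decidable (_ ∨ _))

/-- The state of process `j` at the end of a round that it survives.  Here `σ` is its state during
the round, `heard` is the ordinary message that it receives in the round, with its sender (if any),
and `ga` says whether it receives a "go ahead" message.  A "go ahead" message makes a passive
process active, with its first operation in the next round. -/
def update (n : ℕ) {t : ℕ} (r : ℕ) (j : Fin t) (heard : Option (Fin t × Ordinary)) (ga : Bool) :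
    State t → State t
  | .active todo => if todo.tail = [] then .terminated else .active todo.tail
  | .passive i m r' =>
      match heard with
      | some (k, m') =>
          if IsFinal j m' then .terminated
          else if ga then .active (doWork n j k m') else .passive k m' r
      | none => if ga then .active (doWork n j i m) else .passive i m r'
  | σ => σ

/-! ### Executions -/

/-- The choices of the adversary, which determine an execution.  Process `p` never crashes if
`crashRound p = none`.  If `crashRound p = some r`, then `p` crashes in round `r`, which is the last
round in which it does anything, and of the processes to which it broadcasts in that round exactly
those in `reached p` receive the message.  If `r = 0`, then `p` crashes before it does anything. A
crash between two rounds is a crash in the former with `reached p = univ`. -/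
structure FailurePattern (t : ℕ) where
  crashRound : Fin t → Option ℕ
  reached : Fin t → Finset (Fin t)

variable (n : ℕ) {t : ℕ} (F : FailurePattern t)

/-- The message, if any, that process `q` receives from process `p` in round `r`, if the states
during that round are `σ`.  Messages are received in the round in which they are sent. -/
def received (r : ℕ) (σ : Fin t → State t) (q p : Fin t) : Option Message :=
  match operation n r p (σ p) with
  | some (.send m S) =>
      if q ∈ S ∧ (F.crashRound p = some r → q ∈ F.reached p) then some m else none
  | _ => none

/-- The ordinary message that `q` receives in round `r`, with its sender.  If there were several,
the one from the lowest-numbered sender would count. -/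
def heard (r : ℕ) (σ : Fin t → State t) (q : Fin t) : Option (Fin t × Ordinary) :=
  (List.finRange t).findSome? fun p =>
    match received n F r σ q p with
    | some (.ordinary m) => some (p, m)
    | _ => none

/-- Round `r`: `cfg` is the configuration before it, the result is the one at its end. -/
def round (r : ℕ) (cfg : Fin t → State t) : Fin t → State t :=
  let σ : Fin t → State t := fun p => wake n r p (cfg p)
  fun q =>
    if F.crashRound q = some r then .crashed
    else update n r q (heard n F r σ q) (decide (∃ p, received n F r σ q p = some .goAhead)) (σ q)

/-- The configuration at the end of round `r`.  Round `0` is fictitious: in it process `0` is active,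
and every other process `j` receives from it the ordinary message `(0, g_j)`.  The execution proper
begins with round `1`, in which process `0` begins with subchunk `1`. -/
def run : ℕ → Fin t → State t
  | 0 => fun p =>
      if F.crashRound p = some 0 then .crashed
      else if (p : ℕ) = 0 then .active (continueWork n p 0)
      else .passive ⟨0, p.pos⟩ (.chunk 0 (group t p)) 0
  | r + 1 => round n F (r + 1) (run r)

/-- The state of process `p` during round `r ≥ 1`, after a possible time out. -/
def stateIn (r : ℕ) (p : Fin t) : State t := wake n r p (run n F (r - 1) p)

/-- The number of units of work performed by process `p` in round `r ≥ 1`. -/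
def workIn (r : ℕ) (p : Fin t) : ℕ :=
  match operation n r p (stateIn n F r p) with
  | some (.work _) => 1
  | _ => 0

/-- The number of messages sent by process `p` in round `r ≥ 1`: one for each recipient of its
broadcast.  A broadcast during which `p` crashes is counted in full. -/
def messagesIn (r : ℕ) (p : Fin t) : ℕ :=
  match operation n r p (stateIn n F r p) with
  | some (.send _ S) => S.card
  | _ => 0

/-- The number of units of work performed by all processes in rounds `1, …, R`, counted with
multiplicity. -/
def totalWork (R : ℕ) : ℕ := ∑ r ∈ Finset.Icc 1 R, ∑ p, workIn n F r p

/-- The number of messages, ordinary or "go ahead", sent by all processes in rounds `1, …, R`. -/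
def totalMessages (R : ℕ) : ℕ := ∑ r ∈ Finset.Icc 1 R, ∑ p, messagesIn n F r p

end ProtocolB

/-! Write s = √t and m = n/t. The time-outs telescope: with `offset` p = g_p·GTO(0) + (p mod s)·PTO,
a process whose last ordinary message came from k in round r' polls a member x > k of its group (or
wakes up, if it is x itself) in round r' − offset k + offset x (`timeout_eq`). So let a passive
process have the virtual time r' − offset k, and an active process l in round r the virtual time r −
offset l. A message hands the virtual time of its sender to the recipient, activation never raises
the virtual time, and every operation of an active process advances it by 1.

Statement (d) becomes a comparison of virtual times. If l is not retired and j is passive in a later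
group, then the next message of l to the group of j is due at most `groupSlack` after the virtual
time of j, whereas `offset` grows by more than `groupSlack` from one group to the next. Inside a
group a message comes at least every m + 1 rounds, and `offset` grows by m + 2 per process. Hence
whenever x is polled, all processes below x have retired (`Invariant.retired_of_polled`); in
particular at most one process is active at a time.

The other bounds are potential arguments. Work done plus work left is at most n at the start; it
grows by at most m per process and by s·m more per group, which gives 3n. Ordinary messages sent
plus s times the broadcasts left start below 3ts; they grow by at most 3s per process and 3t per
group, which gives 9ts. Each process sends at most s "go ahead" messages (`Polls`), which adds ts.
Virtual time plus operations left never increases, which bounds the last round.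

All this is one `Invariant` on abstract configurations, in which a state is reduced to a position in
the code. `Invariant.activate` and `ActiveRound.invariant` preserve it; `exists_activeRound` and
`exists_quietRound` show that the rounds of an execution are such steps. -/

namespace ProtocolB

/-! ### Positions in the code -/

/-- The positions of an active process in its code. -/
inductive Pos where
  /-- `u` units of subchunk `c` are left; then comes the message `(c)`. -/
  | unit (c u : ℕ)
  /-- Next comes the message `(c, g)` to group `g`. -/
  | inform (c g : ℕ)
  /-- Next comes the message `(c, g)` to the remainder of the own group. -/
  | report (c g : ℕ)

/-- The parameters `s = √t` and `m = n / t`. -/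
structure Params (n t s m : ℕ) : Prop where
  sq : s * s = t
  mul : n = t * m
  s_pos : 1 ≤ s
  m_pos : 1 ≤ m

/-- `⌈c / s⌉` -/
def ceilQuot (s c : ℕ) : ℕ := (c + s - 1) / s

/-! ### Rounding subchunk numbers up to multiples of √t -/

section ceilQuot
variable {s c : ℕ}

theorem ceilQuot_spec (hs : 1 ≤ s) : c ≤ s * ceilQuot s c ∧ s * ceilQuot s c < c + s := by
  unfold ceilQuot
  have h1 := Nat.div_add_mod (c + s - 1) s
  have h2 := Nat.mod_lt (c + s - 1) hs
  omega

theorem ceilQuot_eq (hs : 1 ≤ s) {q : ℕ} (h1 : c ≤ s * q) (h2 : s * q < c + s) :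
    ceilQuot s c = q := by
  obtain ⟨h3, h4⟩ := ceilQuot_spec (c := c) hs
  apply le_antisymm
  · by_contra h
    have : s * (q + 1) ≤ s * ceilQuot s c := Nat.mul_le_mul_left s (by omega)
    rw [Nat.mul_add] at this
    omega
  · by_contra h
    have : s * (ceilQuot s c + 1) ≤ s * q := Nat.mul_le_mul_left s (by omega)
    rw [Nat.mul_add] at this
    omega

theorem ceilQuot_mul (hs : 1 ≤ s) (q : ℕ) : ceilQuot s (s * q) = q :=
  ceilQuot_eq hs le_rfl (by omega)

theorem mul_ceilQuot (hs : 1 ≤ s) (h : s ∣ c) : s * ceilQuot s c = c := by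
  obtain ⟨q, rfl⟩ := h
  rw [ceilQuot_mul hs]

theorem ceilQuot_succ_of_dvd (hs : 1 ≤ s) (h : s ∣ c) : ceilQuot s (c + 1) = ceilQuot s c + 1 := by
  obtain ⟨q, rfl⟩ := h
  rw [ceilQuot_mul hs]
  apply ceilQuot_eq hs <;> rw [Nat.mul_add] <;> omega

theorem ceilQuot_succ_of_not_dvd (hs : 1 ≤ s) (h : ¬ s ∣ c) :
    ceilQuot s (c + 1) = ceilQuot s c := by
  obtain ⟨h3, h4⟩ := ceilQuot_spec (c := c) hs
  have : c ≠ s * ceilQuot s c := fun h' => h ⟨_, h'⟩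
  apply ceilQuot_eq hs <;> omega

end ceilQuot

namespace Pos

variable (s m t g γ : ℕ)

/-- The subchunk that the next message is about. -/
def label : Pos → ℕ
  | unit c _ => c
  | inform c _ => c
  | report c _ => c

/-- The position when groups `< h` have been informed of `c`. -/
def afterChunk (c h : ℕ) : Option Pos :=
  if h ≤ s then some (inform c h) else if c < t then some (unit (c + 1) m) else none

/-- The next position of a process of group `g`. -/
def next : Pos → Option Pos
  | unit c (u + 1) => some (unit c u)
  | unit c 0 => if s ∣ c then afterChunk s m t c (g + 1) else some (unit (c + 1) m)
  | inform c h => some (report c h)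
  | report c h => afterChunk s m t c (h + 1)

/-- The positions that a process of group `g` can have. -/
def Valid : Pos → Prop
  | unit c u => c ≤ t ∧ u ≤ m ∧ (0 < u → 0 < c)
  | inform c h => c ≤ t ∧ s ∣ c ∧ g < h ∧ h ≤ s
  | report c h => c ≤ t ∧ s ∣ c ∧ g ≤ h ∧ h ≤ s

/-- The label of the next message to group `γ`. -/
def nextLabel : Pos → ℕ
  | unit c _ => s * ceilQuot s c
  | inform c h => if h ≤ γ then c else c + s
  | report c h => if h < γ then c else c + s

/-- The number of operations of a process of group `g` before its next message to group `γ`. -/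
def dist : Pos → ℤ
  -- The units left and the message `(c)`; then `m + 1` rounds for each subchunk up to the next
  -- multiple of `s`; then two broadcasts for each group strictly between `g` and `γ`.
  | unit c u => u + 1 + ((s * ceilQuot s c : ℕ) - c) * (m + 1) + 2 * (γ - g - 1)
  | inform _ h => if h ≤ γ then 2 * (γ - h) else 2 * (s + 1 - h) + s * (m + 1) + 2 * (γ - g - 1)
  | report _ h =>
      if h < γ then 1 + 2 * (γ - h - 1) else 1 + 2 * (s - h) + s * (m + 1) + 2 * (γ - g - 1)

/-- The number of operations before the next message to the own group. -/
def near : Pos → ℤ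
  | unit _ u => u
  | inform _ _ => 1
  | report _ _ => 0

/-- The number of units of work that remain to be done. -/
def works : Pos → ℤ
  | unit c u => u + (t - c) * m
  | inform c _ => (t - c) * m
  | report c _ => (t - c) * m

/-- The number of broadcasts that a process of group `g` still has to make. -/
def sends : Pos → ℤ
  -- Partial checkpoints for `c, …, t`, and full checkpoints at the multiples of `s` from `s *
  -- ceilQuot s c` to `s * s`, each of `2 * (s - g)` broadcasts.
  | unit c _ => 1 + (t - c) + 2 * (s - g) * (s + 1 - ceilQuot s c)
  | inform c h => 2 * (s + 1 - h) + (t - c) + 2 * (s - g) * (s - ceilQuot s c)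
  | report c h => 1 + 2 * (s - h) + (t - c) + 2 * (s - g) * (s - ceilQuot s c)

variable {s m t g γ} {n : ℕ}

theorem next_valid (H : Params n t s m) {p p' : Pos} (hp : p.Valid s m t g)
    (h : p.next s m t g = some p') : p'.Valid s m t g := by
  have hst : s ∣ t := ⟨s, H.sq.symm⟩
  have key : ∀ c k, c ≤ t → s ∣ c → g < k → afterChunk s m t c k = some p' →
      p'.Valid s m t g := by
    intro c k hc hd hk h
    unfold afterChunk at h
    split_ifs at h <;> cases h
    · exact ⟨hc, hd, hk, by assumption⟩
    · exact ⟨by omega, le_rfl, by omega⟩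
  match p, hp, h with
  | unit c (u + 1), ⟨h1, h2, h3⟩, h =>
    cases h; exact ⟨h1, by omega, by omega⟩
  | unit c 0, ⟨h1, h2, h3⟩, h =>
    simp only [next] at h
    split_ifs at h with hd
    · exact key c _ h1 hd (by omega) h
    · cases h
      -- Where no full checkpoint is due, another subchunk exists, because `s ∣ t`.
      have : c ≠ t := fun h' => hd (h' ▸ hst)
      exact ⟨by omega, le_rfl, by omega⟩
  | inform c k, ⟨h1, h2, h3, h4⟩, h =>
    cases h; exact ⟨h1, h2, h3.le, h4⟩
  | report c k, ⟨h1, h2, h3, h4⟩, h =>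
    exact key c _ h1 h2 (by omega) h

theorem dist_nonneg (hs : 1 ≤ s) (hγ : g < γ) {p : Pos} (hp : p.Valid s m t g) :
    0 ≤ p.dist s m g γ := by
  cases p with
  | unit c u =>
    have := (ceilQuot_spec (c := c) hs).1
    have h2 : (0 : ℤ) ≤ ((s * ceilQuot s c : ℕ) - c) * (m + 1) :=
      mul_nonneg (by omega) (by omega)
    simp only [dist]; omega
  | inform c h =>
    have : (0 : ℤ) ≤ s * (m + 1) := by positivity
    obtain ⟨h1, h2, h3, h4⟩ := hp
    simp only [dist]; split_ifs <;> omega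
  | report c h =>
    have : (0 : ℤ) ≤ s * (m + 1) := by positivity
    obtain ⟨h1, h2, h3, h4⟩ := hp
    simp only [dist]; split_ifs <;> omega

theorem near_nonneg (p : Pos) : 0 ≤ p.near := by
  cases p <;> simp [near]

/-- One formula covers both continuations: for `h = s + 1` the full checkpoint is over, and `unit (c
+ 1) m` opens the stretch of `s` subchunks that ends at the multiple `c + s`. -/
theorem afterChunk_far (hs : 1 ≤ s) (hγs : γ ≤ s) {c h : ℕ} (hd : s ∣ c) (hh : h ≤ s + 1)
    {p' : Pos} (hp : afterChunk s m t c h = some p') :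
    p'.nextLabel s γ = (if h ≤ γ then c else c + s) ∧
    p'.dist s m g γ =
      if h ≤ γ then 2 * (γ - h : ℤ) else 2 * (s + 1 - h) + s * (m + 1) + 2 * (γ - g - 1) := by
  unfold afterChunk at hp
  split_ifs at hp with h1 h2 <;> cases hp
  · exact ⟨rfl, rfl⟩
  · have h3 : ¬ h ≤ γ := by omega
    obtain rfl : h = s + 1 := by omega
    simp only [nextLabel, dist, ceilQuot_succ_of_dvd hs hd, h3, if_false, Nat.mul_add, mul_one,
      mul_ceilQuot hs hd]
    refine ⟨trivial, ?_⟩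
    push_cast
    ring

/-- An operation that is not a message to group `γ`. -/
theorem next_far (hs : 1 ≤ s) (hg : g < γ) (hγs : γ ≤ s) {p p' : Pos} (hp : p.Valid s m t g)
    (h : p.next s m t g = some p') (hna : ∀ c, p ≠ inform c γ) :
    p'.nextLabel s γ = p.nextLabel s γ ∧ p'.dist s m g γ = p.dist s m g γ - 1 := by
  match p, hp, h with
  | unit c (u + 1), ⟨h1, h2, h3⟩, h =>
    cases h
    refine ⟨rfl, ?_⟩
    simp only [dist]; push_cast; ring
  | unit c 0, ⟨h1, h2, h3⟩, h =>
    simp only [next] at h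
    split_ifs at h with hd
    · obtain ⟨e1, e2⟩ := afterChunk_far (γ := γ) (g := g) hs hγs hd (by omega) h
      rw [e1, e2, if_pos (by omega), if_pos (by omega)]
      simp only [nextLabel, dist, mul_ceilQuot hs hd]
      refine ⟨trivial, ?_⟩
      push_cast
      ring
    · cases h
      simp only [nextLabel, dist, ceilQuot_succ_of_not_dvd hs hd]
      refine ⟨trivial, ?_⟩
      push_cast
      ring
  | inform c k, ⟨h1, h2, h3, h4⟩, h =>
    cases h
    have : k ≠ γ := fun e => hna c (e ▸ rfl)
    simp only [nextLabel, dist]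
    by_cases hk : k < γ
    · rw [if_pos hk, if_pos hk.le, if_pos hk, if_pos hk.le]; exact ⟨rfl, by ring⟩
    · have hk' : ¬ k ≤ γ := by omega
      rw [if_neg hk, if_neg hk', if_neg hk, if_neg hk']; exact ⟨rfl, by ring⟩
  | report c k, ⟨h1, h2, h3, h4⟩, h =>
    obtain ⟨e1, e2⟩ := afterChunk_far (γ := γ) (g := g) hs hγs h2 (by omega) h
    rw [e1, e2]
    simp only [nextLabel, dist, Nat.lt_iff_add_one_le]
    refine ⟨trivial, ?_⟩
    split_ifs <;> push_cast <;> ring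

theorem works_nonneg {p : Pos} (hp : p.Valid s m t g) : 0 ≤ p.works m t := by
  have key : ∀ c, c ≤ t → (0 : ℤ) ≤ (t - c) * m := fun c hc =>
    mul_nonneg (by omega) (Nat.cast_nonneg m)
  cases p with
  | unit c u => exact add_nonneg (Nat.cast_nonneg u) (key c hp.1)
  | inform c h => exact key c hp.1
  | report c h => exact key c hp.1

theorem ceilQuot_le (H : Params n t s m) {c : ℕ} (hc : c ≤ t) : ceilQuot s c ≤ s := by
  by_contra h
  have h1 := (ceilQuot_spec (c := c) H.s_pos).2
  have : s * (s + 1) ≤ s * ceilQuot s c := Nat.mul_le_mul_left s (by omega)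
  rw [Nat.mul_add, H.sq] at this
  omega

theorem sends_pos (H : Params n t s m) (hg : g ≤ s) {p : Pos} (hp : p.Valid s m t g) :
    1 ≤ p.sends s t g := by
  have key : ∀ c, c ≤ t → (0 : ℤ) ≤ 2 * (s - g) * (s - ceilQuot s c) := by
    intro c hc
    have := ceilQuot_le H hc
    exact mul_nonneg (by omega) (by omega)
  cases p with
  | unit c u =>
    have h1 := hp.1
    have := key c h1
    simp only [sends]
    have e : (2 * (s - g) * (s + 1 - ceilQuot s c) : ℤ) =
      2 * (s - g) * (s - ceilQuot s c) + 2 * (s - g) := by ring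
    rw [e]; omega
  | inform c h =>
    obtain ⟨h1, h2, h3, h4⟩ := hp
    have := key c h1
    simp only [sends]; omega
  | report c h =>
    obtain ⟨h1, h2, h3, h4⟩ := hp
    have := key c h1
    simp only [sends]; omega

theorem afterChunk_count (hs : 1 ≤ s) {c h : ℕ} (hd : s ∣ c) (hh : h ≤ s + 1)
    {p' : Pos} (hp : afterChunk s m t c h = some p') :
    p'.works m t = (t - c) * m ∧
    p'.sends s t g = 2 * (s + 1 - h) + (t - c) + 2 * (s - g) * (s - ceilQuot s c) := by
  unfold afterChunk at hp
  split_ifs at hp with h1 h2 <;> cases hp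
  · exact ⟨rfl, rfl⟩
  · obtain rfl : h = s + 1 := by omega
    simp only [works, sends, ceilQuot_succ_of_dvd hs hd]
    push_cast
    exact ⟨by ring, by ring⟩

/-- An operation is either a unit of work or a broadcast, so `works + sends` drops by exactly one
per round. -/
theorem next_count (hs : 1 ≤ s) (hg : g ≤ s) {p p' : Pos} (hp : p.Valid s m t g)
    (h : p.next s m t g = some p') :
    ((∃ c u, p = unit c (u + 1)) ∧ p'.works m t = p.works m t - 1 ∧
      p'.sends s t g = p.sends s t g) ∨
    ((∀ c u, p ≠ unit c (u + 1)) ∧ p'.works m t = p.works m t ∧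
      p'.sends s t g = p.sends s t g - 1) := by
  match p, hp, h with
  | unit c (u + 1), ⟨h1, h2, h3⟩, h =>
    cases h
    refine Or.inl ⟨⟨_, _, rfl⟩, ?_, rfl⟩
    simp only [works]; push_cast; ring
  | unit c 0, ⟨h1, h2, h3⟩, h =>
    refine Or.inr ⟨by simp, ?_⟩
    simp only [next] at h
    split_ifs at h with hd
    · obtain ⟨e1, e2⟩ := afterChunk_count (g := g) hs hd (by omega) h
      rw [e1, e2]
      simp only [works, sends]
      push_cast
      exact ⟨by ring, by ring⟩
    · cases h
      simp only [works, sends, ceilQuot_succ_of_not_dvd hs hd]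
      push_cast
      exact ⟨by ring, by ring⟩
  | inform c k, ⟨h1, h2, h3, h4⟩, h =>
    cases h
    exact Or.inr ⟨by simp, rfl, by simp only [sends]; ring⟩
  | report c k, ⟨h1, h2, h3, h4⟩, h =>
    obtain ⟨e1, e2⟩ := afterChunk_count (g := g) hs h2 (by omega) h
    refine Or.inr ⟨by simp, ?_⟩
    exact ⟨e1, by rw [e2]; simp only [sends]; push_cast; ring⟩

end Pos
end ProtocolB

namespace ProtocolB

/-! ### Virtual time -/

/-- The group of process `l`, if the groups have `s` members. -/
def grp (s l : ℕ) : ℕ := l / s + 1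

/-- How long a process has to wait for the processes of the groups before it. -/
def groupSlack (s m : ℕ) : ℤ := s * m + 3 * s

/-- Process `p` is polled, by a process of its group, `offset p - offset k` rounds after the last
ordinary message, where `k` is the sender of that message. -/
def offset (s m p : ℕ) : ℤ :=
  grp s p * (groupSlack s m + 1 + (s - 1) * (m + 2)) + (p % s : ℕ) * (m + 2)

section offset
variable {n t s m : ℕ}

theorem grp_mono {i l : ℕ} (h : i ≤ l) : grp s i ≤ grp s l :=
  Nat.succ_le_succ (Nat.div_le_div_right h)

theorem lt_of_grp_lt {i l : ℕ} (h : grp s i < grp s l) : i < l := by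
  by_contra h'
  exact absurd (grp_mono (s := s) (not_lt.1 h')) (by omega)

theorem grp_le (H : Params n t s m) (l : Fin t) : grp s l ≤ s := by
  have : (l : ℕ) < s * s := by rw [H.sq]; exact l.2
  exact Nat.div_lt_of_lt_mul this

theorem one_le_grp (l : ℕ) : 1 ≤ grp s l := Nat.succ_pos _

theorem offset_grp_eq {i l : ℕ} (h : grp s i = grp s l) :
    offset s m l - offset s m i = (l - i : ℤ) * (m + 2) := by
  have h1 := Nat.div_add_mod i s
  have h2 := Nat.div_add_mod l s
  have h3 : i / s = l / s := Nat.succ_injective h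
  rw [h3] at h1
  have : ((l % s : ℕ) : ℤ) - (i % s : ℕ) = l - i := by
    have e1 : ((s * (l / s) : ℕ) : ℤ) + (i % s : ℕ) = i := by exact_mod_cast h1
    have e2 : ((s * (l / s) : ℕ) : ℤ) + (l % s : ℕ) = l := by exact_mod_cast h2
    linarith
  rw [← this]
  unfold offset
  rw [h]
  ring

theorem offset_lt_near {i l : ℕ} (h : grp s i = grp s l) (hil : i < l) :
    offset s m i + (m + 2) ≤ offset s m l := by
  have h1 := offset_grp_eq (m := m) h
  have : (1 : ℤ) * (m + 2) ≤ (l - i : ℤ) * (m + 2) :=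
    mul_le_mul_of_nonneg_right (by omega) (by omega)
  linarith

/-- The summand `(s - 1) * (m + 2)` in the weight of a group absorbs the largest possible position
of `i` in its group. -/
theorem offset_lt_far (hs : 1 ≤ s) {i l : ℕ} (h : grp s i < grp s l) :
    offset s m i + groupSlack s m + 1 ≤ offset s m l := by
  have h1 : i % s ≤ s - 1 := by have := Nat.mod_lt i hs; omega
  have h2 : ((i % s : ℕ) : ℤ) * (m + 2) ≤ (s - 1) * (m + 2) :=
    mul_le_mul_of_nonneg_right (by omega) (by omega)
  have h3 : (0 : ℤ) ≤ ((l % s : ℕ) : ℤ) * (m + 2) := by positivity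
  have h4 : (0 : ℤ) ≤ groupSlack s m + 1 + (s - 1) * (m + 2) := by
    have : (0 : ℤ) ≤ (s - 1) * (m + 2) := mul_nonneg (by omega) (by omega)
    unfold groupSlack; positivity
  have h5 : (grp s i + 1 : ℤ) * (groupSlack s m + 1 + (s - 1) * (m + 2)) ≤
      grp s l * (groupSlack s m + 1 + (s - 1) * (m + 2)) :=
    mul_le_mul_of_nonneg_right (by omega) h4
  unfold offset
  linarith

theorem offset_lt (hs : 1 ≤ s) {i l : ℕ} (hil : i < l) : offset s m i < offset s m l := by
  rcases (grp_mono (s := s) hil.le).lt_or_eq with h | h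
  · have := offset_lt_far (m := m) hs h
    have : (0 : ℤ) ≤ groupSlack s m := by unfold groupSlack; positivity
    linarith
  · have := offset_lt_near (m := m) h hil
    linarith

theorem offset_le (hs : 1 ≤ s) {i l : ℕ} (hil : i ≤ l) : offset s m i ≤ offset s m l := by
  rcases hil.lt_or_eq with h | rfl
  · exact (offset_lt hs h).le
  · exact le_rfl

end offset

/-! ### The invariant -/

/-- What matters of the state of a process: a passive process has received its last message from `k`
at round `r` and starts in position `p` when it becomes active; an active process is in
position `p`. -/
inductive View (t : ℕ) where
  | passive (k : Fin t) (r : ℤ) (p : Pos)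
  | active (p : Pos)
  | retired

variable {n t s m : ℕ} {a a' : Fin t → View t} {r r₁ W W' M M' : ℤ}

/-- Before round `r`, process `l` is in position `p`, or will start in position `p`, and its virtual
time is `v`. -/
def Live (s m : ℕ) (r : ℤ) (a : Fin t → View t) (l : Fin t) (v : ℤ) (p : Pos) : Prop :=
  (∃ k r', a l = .passive k r' p ∧ v = r' - offset s m k) ∨
    (a l = .active p ∧ v = r - offset s m l)

/-- A process `l` may start in position `p` after a message from `k`. -/
def Start (s m : ℕ) {t : ℕ} (k l : Fin t) (p : Pos) : Prop :=
  p.label < t ∧ ((grp s k < grp s l ∧ s ∣ p.label ∧ p = .unit p.label 0) ∨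
    (grp s k = grp s l ∧ k < l ∧ (p = .unit p.label 0 ∨
      ∃ h, p = .report p.label h ∧ p.Valid s m t (grp s l))))

/-- The bound for the messages when process `i` is the next one, or the current one, to be
active. -/
def budget (t s i : ℕ) : ℤ := 3 * t * s + 3 * s * i + 3 * t * (grp s i - 1)

/-- The messages about which the own group may not know. -/
def extra (s : ℕ) : Pos → ℤ
  | .unit _ _ => s
  | .inform _ _ => s
  | .report _ _ => 2 * s

/-- What a later member, with last sender `k` and starting position `q`, of the group of an active
process `l` in position `p` has heard. -/
def Informed (t : ℕ) (l k : Fin t) (q : Pos) : Pos → Prop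
  | .unit _ 0 => True
  | .unit c (_ + 1) => k = l ∧ q.label + 1 = c
  | .inform c _ => k = l ∧ q.label = c
  | .report c _ => c < t

/-- The round by which all is done, for process `0` as the time scale. -/
def horizon (t s m : ℕ) : ℤ := t * (m + 1) + 2 * (s - 1) * (s + 1) + 1 - offset s m 0

/-- Here `r` is the round to come, and `W` and `M` count the units of work and the ordinary messages
so far. Every clause about live processes is stated in virtual time, so that it survives a takeover.
-/
structure Invariant (n s m : ℕ) {t : ℕ} (r : ℤ) (a : Fin t → View t) (W M : ℤ) : Prop where
  passive : ∀ {l k r' p}, a l = .passive k r' p →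
    Start s m k l p ∧ r' < r ∧ r ≤ r' - offset s m k + offset s m l
  active : ∀ {l p}, a l = .active p → p.Valid s m t (grp s l)
  low : ∀ {i p}, a i = .active p → ∀ l < i, a l = .retired
  sender : ∀ {j k r' p}, a j = .passive k r' p →
    (∀ l < k, a l = .retired) ∧ ∀ k' r'' p', a k ≠ .passive k' r'' p'
  -- The label bounds say that the next message to the group of `j` will really be sent, and that
  -- `j` is at most `s` subchunks behind it. The fourth bound says that it arrives in time. The last
  -- one, in the opposite direction, is what restores the fourth when a later group is informed
  -- while a process in between stays passive (`far_old_new`).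
  far : ∀ {l j v p k r' q}, Live s m r a l v p → a j = .passive k r' q → grp s l < grp s j →
    p.nextLabel s (grp s j) ≤ t ∧ q.label ≤ p.nextLabel s (grp s j) ∧
    p.nextLabel s (grp s j) ≤ q.label + s ∧
    v + p.dist s m (grp s l) (grp s j) ≤ r' - offset s m k + groupSlack s m ∧
    r' - offset s m k ≤ v + (s * m + s)
  -- The round in which `j` polls `l` has not passed: a polled process does not stay passive.
  nearPassive : ∀ {l j k r' p k' r'' q}, a l = .passive k' r'' p → a j = .passive k r' q → l < j →
    grp s l = grp s j → r ≤ r' - offset s m k + offset s m l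
  -- In `Informed`, a report has `c < t` because the later members have already terminated on `(t)`
  -- when a report with label `t` comes.
  nearActive : ∀ {l j p k r' q}, a l = .active p → a j = .passive k r' q → l < j →
    grp s l = grp s j → r - offset s m l + p.near ≤ r' - offset s m k + m + 1 ∧
    Informed t l k q p
  -- A successor in the same group repeats at most one subchunk, one in a later group at most `s`
  -- more.
  work : ∀ {l v p}, Live s m r a l v p → W + p.works m t ≤ n + m * l + (grp s l - 1) * (s * m)
  work_le : W ≤ 3 * n
  -- A broadcast is charged with `s` messages, the bound for the size of a group.
  msgActive : ∀ {i p}, a i = .active p → M + s * p.sends s t (grp s i) ≤ budget t s i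
  msgNear : ∀ {i l p k r' q}, a i = .active p → a l = .passive k r' q → i < l →
    grp s i = grp s l → M + s * q.sends s t (grp s l) ≤ budget t s i + extra s p
  msgPassive : ∀ {i l k r' p k' r'' q}, a i = .passive k r' p → a l = .passive k' r'' q → i ≤ l →
    grp s i = grp s l → M + s * q.sends s t (grp s l) ≤ budget t s i
  msg_le : M ≤ 9 * (t * s)
  time : ∀ {l v p}, Live s m r a l v p → v + p.works m t + p.sends s t (grp s l) ≤ horizon t s m

theorem Start.near {k l : Fin t} {p : Pos} (h : Start s m k l p) : p.near = 0 := by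
  obtain ⟨-, ⟨-, -, h⟩ | ⟨-, -, h | ⟨_, h, -⟩⟩⟩ := h <;> rw [h] <;> rfl

theorem Start.works {k l : Fin t} {p : Pos} (h : Start s m k l p) :
    p.works m t = (t - p.label) * m := by
  obtain ⟨-, ⟨-, -, h⟩ | ⟨-, -, h | ⟨_, h, -⟩⟩⟩ := h <;> rw [h] <;> simp [Pos.works, Pos.label]

theorem Start.valid {k l : Fin t} {p : Pos} (h : Start s m k l p) :
    p.Valid s m t (grp s l) := by
  obtain ⟨h0, ⟨-, -, h⟩ | ⟨-, -, h | ⟨_, h, hv⟩⟩⟩ := h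
  · rw [h]; exact ⟨h0.le, Nat.zero_le _, by simp⟩
  · rw [h]; exact ⟨h0.le, Nat.zero_le _, by simp⟩
  · exact hv

theorem Start.lt {k l : Fin t} {p : Pos} (h : Start s m k l p) : k < l := by
  obtain ⟨h0, ⟨h, -, -⟩ | ⟨-, h, -⟩⟩ := h
  · exact lt_of_grp_lt h
  · exact h

theorem Start.informed {k l k' : Fin t} {p q : Pos} (h : Start s m k l p) :
    Informed t l k' q p := by
  obtain ⟨h0, ⟨-, -, h⟩ | ⟨-, -, h | ⟨_, h, hv⟩⟩⟩ := h
  · rw [h]; trivial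
  · rw [h]; trivial
  · rw [h]; exact h0

theorem extra_nonneg (p : Pos) : 0 ≤ extra s p := by
  cases p <;> simp [extra]

/-! ### Polling and activation -/

namespace Invariant

theorem live_valid (h : Invariant n s m r a W M) {l : Fin t} {v p} (hl : Live s m r a l v p) :
    p.Valid s m t (grp s l) := by
  obtain ⟨k, r', h1, -⟩ | ⟨h1, -⟩ := hl
  · exact (h.passive h1).1.valid
  · exact h.active h1

/-- All processes before a polled one are retired. -/
theorem retired_of_polled (H : Params n t s m) (h : Invariant n s m r a W M) {j k : Fin t} {r' q}
    (hj : a j = .passive k r' q) {x : Fin t} (hx : x ≤ j) (hg : grp s x = grp s j)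
    (hr : r' - offset s m k + offset s m x ≤ r) : ∀ l < x, a l = .retired := by
  intro l hl
  have hlj := hl.trans_le hx
  by_contra hne
  -- Equality for an active process; for a passive one this says that its own time-out has not
  -- passed.
  obtain ⟨v, p, hlive, hv⟩ : ∃ v p, Live s m r a l v p ∧ r ≤ v + offset s m l := by
    cases hal : a l with
    | passive k0 r0 p0 =>
      exact ⟨_, _, Or.inl ⟨_, _, hal, rfl⟩, by have := h.passive hal; linarith⟩
    | active p0 => exact ⟨_, _, Or.inr ⟨hal, rfl⟩, by linarith⟩
    | retired => exact (hne hal).elim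
  rcases (grp_mono (s := s) (show (l : ℕ) ≤ x from hl.le)).lt_or_eq with h1 | h1
  · have h2 := (h.far hlive hj (hg ▸ h1)).2.2.2.1
    have h3 := Pos.dist_nonneg H.s_pos (hg ▸ h1) (h.live_valid hlive)
    have h4 := offset_lt_far (m := m) H.s_pos h1
    linarith
  · have h4 := offset_lt_near (m := m) h1 hl
    obtain ⟨k0, r0, hal, hv'⟩ | ⟨hal, hv'⟩ := hlive
    · have := h.nearPassive hal hj hlj (h1.trans hg)
      linarith
    · have h5 := (h.nearActive hal hj hlj (h1.trans hg)).1
      have := p.near_nonneg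
      linarith

/-- Passive processes may become active when they are polled. -/
theorem activate (H : Params n t s m) (h : Invariant n s m r a W M) (hr : r ≤ r₁)
    (hr₁ : r₁ ≤ r + 1) (hret : ∀ l, a l = .retired → a' l = .retired)
    (hpas : ∀ {l k r' p}, a' l = .passive k r' p →
      a l = .passive k r' p ∧ r₁ ≤ r' - offset s m k + offset s m l)
    (hnear : ∀ {l j k r' p k' r'' q}, a' l = .passive k' r'' p → a' j = .passive k r' q → l < j →
      grp s l = grp s j → r₁ ≤ r' - offset s m k + offset s m l)
    (hact : ∀ {l p}, a' l = .active p → (a l = .active p ∧ r₁ = r) ∨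
      ∃ k r', a l = .passive k r' p ∧ r₁ ≤ r' - offset s m k + offset s m l ∧
        ∃ j kj rj q, a j = .passive kj rj q ∧ l ≤ j ∧ grp s l = grp s j ∧
          rj - offset s m kj + offset s m l = r) :
    Invariant n s m r₁ a' W M := by
  -- Activation keeps the position and does not raise the virtual time, so upper bounds on virtual
  -- times persist.
  have hlive : ∀ {l v p}, Live s m r₁ a' l v p → ∃ v', Live s m r a l v' p ∧ v ≤ v' := by
    rintro l v p (⟨k, r', h1, rfl⟩ | ⟨h1, rfl⟩)
    · exact ⟨_, Or.inl ⟨k, r', (hpas h1).1, rfl⟩, le_rfl⟩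
    · obtain ⟨h2, h3⟩ | ⟨k, r', h2, h3, -⟩ := hact h1
      · exact ⟨_, Or.inr ⟨h2, rfl⟩, by rw [h3]⟩
      · exact ⟨_, Or.inl ⟨k, r', h2, rfl⟩, by linarith⟩
  refine ⟨?_, ?_, ?_, ?_, ?_, @hnear, ?_, ?_, h.work_le, ?_, ?_, ?_, h.msg_le, ?_⟩
  · intro l k r' p h1
    obtain ⟨h2, h3⟩ := hpas h1
    exact ⟨(h.passive h2).1, (h.passive h2).2.1.trans_le hr, h3⟩
  · intro l p h1
    obtain ⟨h2, h3⟩ | ⟨k, r', h2, h3, -⟩ := hact h1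
    · exact h.active h2
    · exact (h.passive h2).1.valid
  · intro i p h1 l hl
    apply hret
    obtain ⟨h2, h3⟩ | ⟨k, r', h2, h3, j, kj, rj, q, h4, h5, h6, h7⟩ := hact h1
    · exact h.low h2 l hl
    · exact h.retired_of_polled H h4 h5 h6 h7.le l hl
  · intro j k r' p h1
    obtain ⟨h2, h3⟩ := h.sender (hpas h1).1
    exact ⟨fun l hl => hret l (h2 l hl), fun k' r'' p' h4 => h3 _ _ _ (hpas h4).1⟩
  · intro l j v p k r' q h1 h2 h3
    obtain ⟨v', h4, h5⟩ := hlive h1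
    obtain ⟨f1, f2, f3, f4, f5⟩ := h.far h4 (hpas h2).1 h3
    refine ⟨f1, f2, f3, by linarith, ?_⟩
    obtain ⟨k0, r0, h6, h7⟩ | ⟨h6, h7⟩ := h1
    · exact (h.far (Or.inl ⟨_, _, (hpas h6).1, h7⟩) (hpas h2).1 h3).2.2.2.2
    · obtain ⟨h8, h9⟩ | ⟨k0, r0, h8, h9, x, kx, rx, qx, h10, h11, h12, h13⟩ := hact h6
      · exact (h.far (Or.inr ⟨h8, h7.trans (by rw [h9])⟩) (hpas h2).1 h3).2.2.2.2
      -- The only lower bound on a virtual time: the new one of `l` is at least that of its poller,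
      -- which is in the same group.
      · have := (h.far (Or.inl ⟨kx, rx, h10, rfl⟩) (hpas h2).1 (h12 ▸ h3)).2.2.2.2
        linarith
  · intro l j p k r' q h1 h2 h3 h4
    obtain ⟨h8, h9⟩ | ⟨k0, r0, h8, h9, x, kx, rx, qx, h10, h11, h12, h13⟩ := hact h1
    · rw [h9]; exact h.nearActive h8 (hpas h2).1 h3 h4
    · have := h.nearPassive h8 (hpas h2).1 h3 h4
      have hs := (h.passive h8).1
      rw [hs.near]
      exact ⟨by linarith, hs.informed⟩
  · intro l v p h1
    obtain ⟨v', h4, h5⟩ := hlive h1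
    exact h.work h4
  · intro i p h1
    obtain ⟨h8, h9⟩ | ⟨k0, r0, h8, -⟩ := hact h1
    · exact h.msgActive h8
    · exact h.msgPassive h8 h8 le_rfl rfl
  · intro i l p k r' q h1 h2 h3 h4
    obtain ⟨h8, h9⟩ | ⟨k0, r0, h8, -⟩ := hact h1
    · exact h.msgNear h8 (hpas h2).1 h3 h4
    · have := h.msgPassive h8 (hpas h2).1 h3.le h4
      have := extra_nonneg (s := s) p
      linarith
  · intro i l k r' p k' r'' q h1 h2 h3 h4
    exact h.msgPassive (hpas h1).1 (hpas h2).1 h3 h4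
  · intro l v p h1
    obtain ⟨v', h4, h5⟩ := hlive h1
    have := h.time h4
    linarith

end Invariant
end ProtocolB

namespace ProtocolB

/-! ### Rounds with an active process -/

variable {n t s m : ℕ} {a a' : Fin t → View t} {r W W' M M' : ℤ}

/-- The next operation of process `i` in position `p` is a message to process `q`. -/
def Addressed (s i q : ℕ) : Pos → Prop
  | .unit _ 0 => i < q ∧ grp s q = grp s i
  | .unit _ (_ + 1) => False
  | .inform _ h => grp s q = h
  | .report _ _ => i < q ∧ grp s q = grp s i

/-- The starting position of a recipient of the message that is sent in position `p`. -/
def Pos.startAfter : Pos → Pos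
  | .inform c _ => .unit c 0
  | p => p

/-- Position `p` is one in which a unit of work is performed. -/
def Pos.IsWork : Pos → Prop
  | .unit _ (_ + 1) => True
  | _ => False

/-- A round in which process `i` is active, in position `p`. -/
structure ActiveRound (s m : ℕ) {t : ℕ} (r : ℤ) (a a' : Fin t → View t) (i : Fin t) (p : Pos)
    (W W' M M' : ℤ) : Prop where
  pos : a i = .active p
  strict : ∀ {l k r' q}, a l = .passive k r' q → r < r' - offset s m k + offset s m l
  self : a' i = .retired ∨ ∃ p', p.next s m t (grp s i) = some p' ∧ a' i = .active p'
  others : ∀ q ≠ i, a' q = .retired ∨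
    (∃ k r' x, a q = .passive k r' x ∧ a' q = .passive k r' x ∧
      (¬ Addressed s i q p ∨ a' i = .retired)) ∨
    (∃ k r' x, a q = .passive k r' x ∧ Addressed s i q p ∧ p.label < t ∧
      a' q = .passive i r p.startAfter)
  count : (p.IsWork ∧ W' = W + 1 ∧ M' = M) ∨ (¬ p.IsWork ∧ W' = W ∧ M ≤ M' ∧ M' ≤ M + s)

theorem Pos.Valid.label_le {g : ℕ} {p : Pos} (hp : p.Valid s m t g) : p.label ≤ t := by
  cases p <;> exact hp.1

theorem Pos.label_startAfter (p : Pos) : p.startAfter.label = p.label := by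
  cases p <;> rfl

theorem Addressed.not_isWork {i q : ℕ} {p : Pos} (h : Addressed s i q p) : ¬ p.IsWork := by
  match p, h with
  | .unit c 0, _ => exact id
  | .inform c k, _ => exact id
  | .report c k, _ => exact id

theorem Addressed.lt {i q : ℕ} {p : Pos} (h : Addressed s i q p)
    (hp : p.Valid s m t (grp s i)) : i < q := by
  match p, h, hp with
  | .unit c 0, h, _ => exact h.1
  | .inform c k, h, hp => exact lt_of_grp_lt (h ▸ hp.2.2.1)
  | .report c k, h, _ => exact h.1

theorem Addressed.eq_inform {i q : ℕ} {p : Pos} (h : Addressed s i q p)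
    (hg : grp s i < grp s q) : p = .inform p.label (grp s q) := by
  match p, h with
  | .unit c 0, h => exact absurd h.2 hg.ne'
  | .inform c k, h => cases h; rfl
  | .report c k, h => exact absurd h.2 hg.ne'

theorem Addressed.grp_le {i q : ℕ} {p : Pos} (h : Addressed s i q p)
    (hp : p.Valid s m t (grp s i)) : grp s i ≤ grp s q :=
  grp_mono (h.lt hp).le

theorem Addressed.grp_eq {i q q' : ℕ} {p : Pos} (h : Addressed s i q p)
    (h' : Addressed s i q' p) : grp s q = grp s q' := by
  match p, h, h' with
  | .unit c 0, h, h' => exact h.2.trans h'.2.symm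
  | .inform c k, h, h' => exact h.trans h'.symm
  | .report c k, h, h' => exact h.2.trans h'.2.symm

theorem Addressed.start {i q : Fin t} {p : Pos} (h : Addressed s i q p)
    (hp : p.Valid s m t (grp s i)) (hl : p.label < t) : Start s m i q p.startAfter := by
  have hlt := h.lt hp
  match p, h, hp with
  | .unit c 0, h, hp => exact ⟨hl, Or.inr ⟨h.2.symm, hlt, Or.inl rfl⟩⟩
  | .inform c k, h, hp =>
    exact ⟨hl, Or.inl ⟨h ▸ hp.2.2.1, hp.2.1, rfl⟩⟩
  | .report c k, h, hp =>
    exact ⟨hl, Or.inr ⟨h.2.symm, hlt, Or.inr ⟨k, rfl, h.2 ▸ hp⟩⟩⟩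

/-- A recipient in group `g'` starts in a position that is equivalent for a later group `γ`. -/
theorem Addressed.far_startAfter (hs : 1 ≤ s) {i q γ : ℕ} {p : Pos} (h : Addressed s i q p)
    (hp : p.Valid s m t (grp s i)) (hγ : grp s q < γ) :
    p.startAfter.nextLabel s γ = p.nextLabel s γ ∧
    p.startAfter.dist s m (grp s q) γ ≤ p.dist s m (grp s i) γ := by
  match p, h, hp with
  | .unit c 0, h, hp => rw [h.2]; exact ⟨rfl, le_rfl⟩
  | .inform c k, h, hp =>
    cases h
    simp only [Pos.startAfter, Pos.nextLabel, Pos.dist, if_pos hγ.le, mul_ceilQuot hs hp.2.1]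
    refine ⟨trivial, ?_⟩
    push_cast
    linarith
  | .report c k, h, hp => rw [h.2]; exact ⟨rfl, le_rfl⟩

theorem Addressed.works_startAfter {i q : ℕ} {p : Pos} (h : Addressed s i q p) :
    p.startAfter.works m t = p.works m t := by
  match p, h with
  | .unit c 0, h => rfl
  | .inform c k, h => simp [Pos.startAfter, Pos.works]
  | .report c k, h => rfl

/-- A recipient in the sender's group would start by repeating the broadcast. One in a later group
makes a single partial checkpoint in place of the two broadcasts about its group, and has fewer
groups to inform later on. -/
theorem Addressed.sends_startAfter (H : Params n t s m) {i q : Fin t} {p : Pos}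
    (h : Addressed s i q p) (hp : p.Valid s m t (grp s i)) :
    (grp s i = grp s q ∧ p.startAfter.sends s t (grp s q) = p.sends s t (grp s i)) ∨
    (grp s i < grp s q ∧ p.startAfter.sends s t (grp s q) ≤ p.sends s t (grp s i) - 1) := by
  match p, h, hp with
  | .unit c 0, h, hp => rw [h.2]; exact Or.inl ⟨rfl, rfl⟩
  | .inform c k, h, hp =>
    cases h
    refine Or.inr ⟨hp.2.2.1, ?_⟩
    simp only [Pos.startAfter, Pos.sends]
    have h1 := Pos.ceilQuot_le H hp.1
    have h2 := hp.2.2.1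
    have : (2 * (s - grp s q) * (s - ceilQuot s c) : ℤ) ≤
        2 * (s - grp s i) * (s - ceilQuot s c) :=
      mul_le_mul_of_nonneg_right (by omega) (by omega)
    linarith
  | .report c k, h, hp => rw [h.2]; exact Or.inl ⟨rfl, rfl⟩

theorem Pos.afterChunk_near (hm : 1 ≤ m) {c h : ℕ} {p' : Pos}
    (hp : afterChunk s m t c h = some p') : p'.near ≤ m := by
  unfold afterChunk at hp
  split_ifs at hp <;> cases hp
  · simp only [near]; omega
  · simp only [near]; omega

theorem Pos.afterChunk_informed (hm : 1 ≤ m) {c h : ℕ} {p' : Pos} {l : Fin t} {q : Pos}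
    (hp : afterChunk s m t c h = some p') (hq : q.label = c) : Informed t l l q p' := by
  obtain ⟨m', rfl⟩ : ∃ m', m = m' + 1 := ⟨m - 1, by omega⟩
  unfold afterChunk at hp
  split_ifs at hp <;> cases hp
  · exact ⟨rfl, hq⟩
  · exact ⟨rfl, by omega⟩

theorem Addressed.next_near (hm : 1 ≤ m) {i q : ℕ} {p p' : Pos} {l : Fin t} {x : Pos}
    (h : Addressed s i q p)
    (hp : p.Valid s m t (grp s i)) (hg : grp s i = grp s q)
    (hn : p.next s m t (grp s i) = some p') (hx : x.label = p.label) :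
    p'.near ≤ m ∧ Informed t l l x p' := by
  match p, h, hp, hn with
  | .unit c 0, h, hp, hn =>
    simp only [Pos.next] at hn
    split_ifs at hn
    · exact ⟨Pos.afterChunk_near hm hn, Pos.afterChunk_informed hm hn hx⟩
    · cases hn
      obtain ⟨m', rfl⟩ : ∃ m', m = m' + 1 := ⟨m - 1, by omega⟩
      exact ⟨le_rfl, rfl, congrArg (· + 1) hx⟩
  | .inform c k, h, hp, hn => cases h; exact absurd hg hp.2.2.1.ne
  | .report c k, h, hp, hn =>
    exact ⟨Pos.afterChunk_near hm hn, Pos.afterChunk_informed hm hn hx⟩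

/-- What happens if the next operation is not a message to the own group. -/
theorem next_near_of_not_addressed {i q : ℕ} {p p' : Pos} {l k : Fin t} {x : Pos}
    (h : ¬ Addressed s i q p) (hiq : i < q) (hg : grp s i = grp s q)
    (hn : p.next s m t (grp s i) = some p') (hx : Informed t l k x p) (hxt : x.label < t) :
    p'.near ≤ p.near - 1 ∧ Informed t l k x p' ∧
      ((p.IsWork ∧ extra s p' = extra s p) ∨ extra s p' = extra s p + s) := by
  match p, h, hn, hx with
  | .unit c 0, h, hn, hx => exact absurd ⟨hiq, hg.symm⟩ h
  | .unit c (u + 1), h, hn, hx =>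
    cases hn
    refine ⟨by simp [Pos.near], ?_, Or.inl ⟨trivial, rfl⟩⟩
    cases u with
    | zero => trivial
    | succ u => exact hx
  | .inform c k, h, hn, hx =>
    cases hn
    exact ⟨by simp [Pos.near], hx.2 ▸ hxt, Or.inr (by simp only [extra]; ring)⟩
  | .report c k, h, hn, hx => exact absurd ⟨hiq, hg.symm⟩ h

/-- Compared with a process of an earlier group, a process has at most `3 s` more broadcasts to
make. -/
theorem sends_le_of_far (H : Params n t s m) {g γ c : ℕ} (hg : g < γ) (hγ : γ ≤ s)
    (hct : c < t) (hc : s ∣ c) {p : Pos} (hp : p.Valid s m t g)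
    (h1 : p.nextLabel s γ ≤ c + s) :
    (Pos.unit c 0).sends s t γ ≤ p.sends s t g + 3 * s := by
  have hs := H.s_pos
  obtain ⟨x, rfl⟩ := hc
  have hxs : x < s := by
    by_contra hx
    have : s * s ≤ s * x := Nat.mul_le_mul_left s (not_lt.1 hx)
    rw [H.sq] at this; omega
  have cancel : ∀ {y z : ℕ}, s * y ≤ s * z → y ≤ z := fun h => Nat.le_of_mul_le_mul_left h hs
  have mono : ∀ {y z : ℤ}, 0 ≤ y → y ≤ z →
      (2 * (s - γ) * y : ℤ) ≤ 2 * (s - g) * z := by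
    intro y z h0 hyz
    calc (2 * (s - γ) * y : ℤ) ≤ 2 * (s - g) * y := mul_le_mul_of_nonneg_right (by omega) h0
      _ ≤ _ := mul_le_mul_of_nonneg_left hyz (by omega)
  -- The loss `3 * s` consists of at most `s` partial checkpoints and the at most `2 * s` broadcasts
  -- of one full checkpoint.
  simp only [Pos.sends, ceilQuot_mul hs]
  match p, hp, h1 with
  | .unit c u, hp, h1 =>
    simp only [Pos.nextLabel] at h1 ⊢
    have h2 : ceilQuot s c ≤ x + 1 := cancel (by rw [Nat.mul_add]; omega)
    have h3 := (ceilQuot_spec (c := c) hs).1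
    have h4 := mono (y := s - x) (z := s + 1 - ceilQuot s c) (by omega) (by omega)
    have h5 : (c : ℤ) ≤ s * x + s := by exact_mod_cast h3.trans h1
    push_cast
    linarith
  | .inform c k, ⟨hc1, hc2, hk1, hk2⟩, h1 =>
    obtain ⟨y, rfl⟩ := hc2
    simp only [Pos.nextLabel, ceilQuot_mul hs] at h1 ⊢
    split_ifs at h1 with hk
    · have h2 : y ≤ x + 1 := cancel (by rw [Nat.mul_add]; omega)
      have h4 := mono (y := s - x - 1) (z := s - y) (by omega) (by omega)
      have h5 : ((s * y : ℕ) : ℤ) ≤ s * x + s := by exact_mod_cast h1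
      push_cast at *
      linarith
    · have h2 : y ≤ x := cancel (by omega)
      have h4 := mono (y := s - x) (z := s - y) (by omega) (by omega)
      have h5 : ((s * y : ℕ) : ℤ) ≤ s * x := by exact_mod_cast (by omega : s * y ≤ s * x)
      push_cast at *
      linarith
  | .report c k, ⟨hc1, hc2, hk1, hk2⟩, h1 =>
    obtain ⟨y, rfl⟩ := hc2
    simp only [Pos.nextLabel, ceilQuot_mul hs] at h1 ⊢
    split_ifs at h1 with hk
    · have h2 : y ≤ x + 1 := cancel (by rw [Nat.mul_add]; omega)
      have h4 := mono (y := s - x - 1) (z := s - y) (by omega) (by omega)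
      have h5 : ((s * y : ℕ) : ℤ) ≤ s * x + s := by exact_mod_cast h1
      push_cast at *
      linarith
    · have h2 : y ≤ x := cancel (by omega)
      have h4 := mono (y := s - x) (z := s - y) (by omega) (by omega)
      have h5 : ((s * y : ℕ) : ℤ) ≤ s * x := by exact_mod_cast (by omega : s * y ≤ s * x)
      push_cast at *
      linarith

namespace ActiveRound

variable {i : Fin t} {p : Pos}

theorem active_eq (A : ActiveRound s m r a a' i p W W' M M') {l : Fin t} {p' : Pos}
    (hl : a' l = .active p') : l = i := by
  by_contra hne
  obtain h | ⟨k, r', x, -, h, -⟩ | ⟨k, r', x, -, -, -, h⟩ := A.others l hne <;>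
    rw [hl] at h <;> cases h

theorem next (A : ActiveRound s m r a a' i p W W' M M') {l : Fin t} {p' : Pos}
    (hl : a' l = .active p') : l = i ∧ p.next s m t (grp s i) = some p' := by
  obtain rfl := A.active_eq hl
  refine ⟨rfl, ?_⟩
  obtain h | ⟨p'', h, h'⟩ := A.self <;> simp_all

/-- Everything below the active process is retired, so a passive process lies above it. An addressed
process that stays passive misses the message only if the sender has retired. -/
theorem passive_cases (h : Invariant n s m r a W M) (A : ActiveRound s m r a a' i p W W' M M')
    {q k : Fin t} {r' : ℤ} {x : Pos} (hq : a' q = .passive k r' x) :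
    i < q ∧ ((a q = .passive k r' x ∧ (¬ Addressed s i q p ∨ a' i = .retired)) ∨
      (k = i ∧ r' = r ∧ x = p.startAfter ∧ Addressed s i q p ∧ p.label < t ∧
        ∃ k0 r0 x0, a q = .passive k0 r0 x0)) := by
  have hne : q ≠ i := by
    rintro rfl
    obtain h | ⟨p', -, h⟩ := A.self <;> rw [hq] at h <;> cases h
  have hlt : ∀ {k0 r0 x0}, a q = .passive k0 r0 x0 → i < q := by
    intro k0 r0 x0 h0
    by_contra h1
    have := h.low A.pos q (lt_of_le_of_ne (not_lt.1 h1) hne)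
    rw [h0] at this; cases this
  obtain h1 | ⟨k0, r0, x0, h1, h2, h3⟩ | ⟨k0, r0, x0, h1, h2, h3, h4⟩ := A.others q hne
  · rw [hq] at h1; cases h1
  · rw [hq] at h2; cases h2
    exact ⟨hlt h1, Or.inl ⟨h1, h3⟩⟩
  · rw [hq] at h4; cases h4
    exact ⟨hlt h1, Or.inr ⟨rfl, rfl, rfl, h2, h3, _, _, _, h1⟩⟩

theorem retired (A : ActiveRound s m r a a' i p W W' M M')
    {q : Fin t} (hq : a q = .retired) : a' q = .retired := by
  have hne : q ≠ i := by rintro rfl; rw [A.pos] at hq; cases hq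
  obtain h1 | ⟨k0, r0, x0, h1, h2, h3⟩ | ⟨k0, r0, x0, h1, h2, h3, h4⟩ := A.others q hne
  · exact h1
  · rw [hq] at h1; cases h1
  · rw [hq] at h1; cases h1

theorem live (A : ActiveRound s m r a a' i p W W' M M') : Live s m r a i (r - offset s m i) p :=
  Or.inr ⟨A.pos, rfl⟩

theorem valid (h : Invariant n s m r a W M) (A : ActiveRound s m r a a' i p W W' M M') :
    p.Valid s m t (grp s i) := h.active A.pos

/-- The last sender to a process is not later than the active process. -/
theorem sender_le (h : Invariant n s m r a W M) (A : ActiveRound s m r a a' i p W W' M M')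
    {q k : Fin t} {r' : ℤ} {x : Pos} (hq : a q = .passive k r' x) : k ≤ i := by
  by_contra hk
  have := (h.sender hq).1 i (not_le.1 hk)
  rw [A.pos] at this; cases this

/-- The last sender is at most `i`, hence in an earlier group than `q`, and groups inform later
groups only of multiples of `s`. -/
theorem start_far (h : Invariant n s m r a W M) (A : ActiveRound s m r a a' i p W W' M M')
    {q k : Fin t} {r' : ℤ} {x : Pos} (hq : a q = .passive k r' x) (hg : grp s i < grp s q) :
    x = .unit x.label 0 ∧ s ∣ x.label ∧ x.label < t := by
  have h1 := grp_mono (s := s) (show (k : ℕ) ≤ i from A.sender_le h hq)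
  obtain ⟨h0, ⟨-, h2, h3⟩ | ⟨h2, -⟩⟩ := (h.passive hq).1
  · exact ⟨h3, h2, h0⟩
  · omega

end ActiveRound
end ProtocolB

namespace ProtocolB

/-! ### The invariant in rounds with an active process -/

variable {n t s m : ℕ} {a a' : Fin t → View t} {r W W' M M' : ℤ}

namespace ActiveRound

variable {i : Fin t} {p : Pos}

/-- `3 * s` pays for `extra`, which is at most `2 * s`, and for the broadcast of the current round;
`3 * t = s * (3 * s)` pays for the loss in `sends_le_of_far`. -/
theorem budget_succ {i l : ℕ} (hil : i < l) :
    budget t s i + 3 * s ≤ budget t s l ∧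
    (grp s i < grp s l → budget t s i + 3 * s + 3 * t ≤ budget t s l) := by
  have h1 := grp_mono (s := s) hil.le
  have h2 : (3 * s * (i + 1) : ℤ) ≤ 3 * s * l := mul_le_mul_of_nonneg_left (by omega) (by omega)
  have h3 : (3 * t * (grp s i - 1) : ℤ) ≤ 3 * t * (grp s l - 1) :=
    mul_le_mul_of_nonneg_left (by omega) (by omega)
  unfold budget
  refine ⟨by linarith, fun h => ?_⟩
  have h4 : (3 * t * (grp s i - 1 + 1) : ℤ) ≤ 3 * t * (grp s l - 1) :=
    mul_le_mul_of_nonneg_left (by omega) (by omega)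
  linarith

theorem budget_le (H : Params n t s m) (i : Fin t) : budget t s i ≤ 9 * (t * s) := by
  have h1 : (3 * s * i : ℤ) ≤ 3 * s * t :=
    mul_le_mul_of_nonneg_left (by have := i.2; omega) (by omega)
  have h2 : (3 * t * (grp s i - 1) : ℤ) ≤ 3 * t * s :=
    mul_le_mul_of_nonneg_left (by have := grp_le H i; omega) (by omega)
  unfold budget
  linarith

/-- All processes polled in a round with an active process are at most this process. -/
theorem not_polled (H : Params n t s m) (h : Invariant n s m r a W M)
    (A : ActiveRound s m r a a' i p W W' M M') {j k : Fin t} {r' : ℤ} {q : Pos}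
    (hj : a j = .passive k r' q) {x : Fin t} (hx : x ≤ j) (hg : grp s x = grp s j) (hi : i < x) :
    r + 1 ≤ r' - offset s m k + offset s m x := by
  by_contra hr
  have := h.retired_of_polled H hj hx hg (by linarith [not_le.1 hr]) i hi
  rw [A.pos] at this; cases this

theorem passive_step (H : Params n t s m) (h : Invariant n s m r a W M)
    (A : ActiveRound s m r a a' i p W W' M M') {l k : Fin t} {r' : ℤ} {x : Pos}
    (hl : a' l = .passive k r' x) :
    Start s m k l x ∧ r' < r + 1 ∧ r + 1 ≤ r' - offset s m k + offset s m l := by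
  obtain ⟨hil, ⟨h1, -⟩ | ⟨rfl, rfl, rfl, h2, h3, -⟩⟩ := A.passive_cases h hl
  · obtain ⟨h2, h3, h4⟩ := h.passive h1
    exact ⟨h2, by linarith, A.strict h1⟩
  · have := offset_lt (m := m) H.s_pos hil
    exact ⟨h2.start (A.valid h) h3, by linarith, by linarith⟩

theorem far_self (H : Params n t s m) (h : Invariant n s m r a W M)
    (A : ActiveRound s m r a a' i p W W' M M') {j k : Fin t} {r' : ℤ} {p' q : Pos}
    (hi : a' i = .active p') (hj : a' j = .passive k r' q) (hg : grp s i < grp s j) :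
    p'.nextLabel s (grp s j) ≤ t ∧ q.label ≤ p'.nextLabel s (grp s j) ∧
    p'.nextLabel s (grp s j) ≤ q.label + s ∧
    r + 1 - offset s m i + p'.dist s m (grp s i) (grp s j) ≤
      r' - offset s m k + groupSlack s m ∧
    r' - offset s m k ≤ r + 1 - offset s m i + (s * m + s) := by
  have hn := (A.next hi).2
  have hv := A.valid h
  have hjs := grp_le H j
  obtain ⟨hij, ⟨h1, h2 | h2⟩ | ⟨rfl, rfl, rfl, h2, h3, -⟩⟩ := A.passive_cases h hj
  · obtain ⟨f1, f2, f3, f4, f5⟩ := h.far A.live h1 hg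
    obtain ⟨e1, e2⟩ := Pos.next_far (γ := grp s j) H.s_pos hg hjs hv hn (by
      rintro c rfl; exact h2 rfl)
    rw [e1, e2]
    exact ⟨f1, f2, f3, by linarith, by linarith⟩
  · rw [hi] at h2; cases h2
  · have hp := h2.eq_inform hg
    generalize p.label = c at *
    subst hp
    cases hn
    obtain ⟨v1, ⟨x, rfl⟩, v3, v4⟩ := hv
    have h3 : s * x < t := h3
    have h4 : s * x + s ≤ t := by
      rw [← H.sq] at h3 ⊢
      have := Nat.lt_of_mul_lt_mul_left h3
      calc s * x + s = s * (x + 1) := by ring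
        _ ≤ s * s := Nat.mul_le_mul_left s this
    have hp := one_le_grp (s := s) (k : ℕ)
    have : (0 : ℤ) ≤ s * m := by positivity
    -- The group of `j` has just been informed, so a full cycle lies ahead: together with the
    -- current round it takes `s * m + 3 * s - 2 * grp s k` rounds. This is where `groupSlack` comes
    -- from.
    simp only [Pos.nextLabel, Pos.dist, lt_irrefl, if_false, Pos.startAfter, Pos.label]
    refine ⟨h4, by omega, le_rfl, ?_, by linarith⟩
    unfold groupSlack
    have : (1 : ℤ) ≤ grp s k := by exact_mod_cast hp
    linarith

theorem far_new_old (H : Params n t s m) (h : Invariant n s m r a W M)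
    (A : ActiveRound s m r a a' i p W W' M M') {l j k : Fin t} {r' : ℤ} {q : Pos}
    (hl : Addressed s i l p) (hj : a j = .passive k r' q) (hg : grp s l < grp s j) :
    p.startAfter.nextLabel s (grp s j) ≤ t ∧ q.label ≤ p.startAfter.nextLabel s (grp s j) ∧
    p.startAfter.nextLabel s (grp s j) ≤ q.label + s ∧
    r - offset s m i + p.startAfter.dist s m (grp s l) (grp s j) ≤
      r' - offset s m k + groupSlack s m ∧
    r' - offset s m k ≤ r - offset s m i + (s * m + s) := by
  have hv := A.valid h
  obtain ⟨f1, f2, f3, f4, f5⟩ := h.far A.live hj ((hl.grp_le hv).trans_lt hg)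
  obtain ⟨e1, e2⟩ := hl.far_startAfter H.s_pos hv hg
  rw [e1]
  exact ⟨f1, f2, f3, by linarith, f5⟩

/-- If `l` is in a later group than `i`, the two-sided bounds for the pair `i`, `l` transfer to the
pair `l`, `j`. If `l` is in the group of `i`, then `Informed` shows that its last message came from
`i` and has the same label. -/
theorem far_old_new (H : Params n t s m) (h : Invariant n s m r a W M)
    (A : ActiveRound s m r a a' i p W W' M M') {l j k : Fin t} {r' : ℤ} {x : Pos}
    (hl : a l = .passive k r' x) (hil : i < l) (hj : Addressed s i j p) (hc : p.label < t)
    (hg : grp s l < grp s j) :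
    x.nextLabel s (grp s j) ≤ t ∧ p.startAfter.label ≤ x.nextLabel s (grp s j) ∧
    x.nextLabel s (grp s j) ≤ p.startAfter.label + s ∧
    r' - offset s m k + x.dist s m (grp s l) (grp s j) ≤
      r - offset s m i + groupSlack s m ∧
    r - offset s m i ≤ r' - offset s m k + (s * m + s) := by
  have hs := H.s_pos
  have hv := A.valid h
  have hgil := grp_mono (s := s) (show (i : ℕ) ≤ l from hil.le)
  have hjs := grp_le H j
  have hp := hj.eq_inform (hgil.trans_lt hg)
  rw [Pos.label_startAfter]
  generalize p.label = c at *
  subst hp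
  obtain ⟨v1, v2, v3, v4⟩ := hv
  have h4 : c + s ≤ t := by
    obtain ⟨y, rfl⟩ := v2
    rw [← H.sq] at hc ⊢
    have := Nat.lt_of_mul_lt_mul_left hc
    calc s * y + s = s * (y + 1) := by ring
      _ ≤ s * s := Nat.mul_le_mul_left s this
  have hm1 : (s : ℤ) * 1 ≤ s * m :=
    mul_le_mul_of_nonneg_left (by have := H.m_pos; omega) (by omega)
  have hm2 : (1 : ℤ) * m ≤ s * m := mul_le_mul_of_nonneg_right (by omega) (by omega)
  have hi1 : (1 : ℤ) ≤ grp s i := by exact_mod_cast one_le_grp (s := s) i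
  rcases hgil.lt_or_eq with hg' | hg'
  · obtain ⟨e1, e2, e3⟩ := A.start_far h hl hg'
    obtain ⟨f1, f2, f3, f4, f5⟩ := h.far A.live hl hg'
    simp only [Pos.nextLabel, Pos.dist, if_neg (not_le.2 hg)] at f1 f2 f3 f4
    generalize x.label = d at *
    subst e1
    simp only [Pos.nextLabel, Pos.dist, mul_ceilQuot hs e2]
    have g1 : (grp s i : ℤ) + 1 ≤ grp s l := by exact_mod_cast hg'
    have g2 : (grp s j : ℤ) ≤ s := by exact_mod_cast hjs
    unfold groupSlack at f4 ⊢
    refine ⟨e3.le, by omega, by omega, ?_, by linarith⟩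
    push_cast
    linarith
  · obtain ⟨n1, n2, n3⟩ := h.nearActive A.pos hl hil hg'
    subst n2
    have hV : r' < r := (h.passive hl).2.1
    simp only [Pos.near] at n1
    obtain ⟨s0, ⟨s1, -, -⟩ | ⟨-, -, s3 | ⟨y, s3, s4⟩⟩⟩ := (h.passive hl).1
    · omega
    · rw [n3] at s3
      subst s3
      simp only [Pos.nextLabel, Pos.dist, mul_ceilQuot hs v2]
      refine ⟨v1, le_rfl, by omega, ?_, by linarith⟩
      push_cast
      unfold groupSlack
      linarith
    · rw [n3] at s3
      subst s3
      obtain ⟨w1, w2, w3, w4⟩ := s4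
      simp only [Pos.nextLabel, Pos.dist]
      unfold groupSlack
      refine ⟨by split_ifs <;> omega, by split_ifs <;> omega, by split_ifs <;> omega, ?_,
        by linarith⟩
      split_ifs with hy
      · linarith
      · have : (grp s l : ℤ) ≤ y := by exact_mod_cast w3
        linarith

theorem near_step (H : Params n t s m) (h : Invariant n s m r a W M)
    (A : ActiveRound s m r a a' i p W W' M M') {j k : Fin t} {r' : ℤ} {p' q : Pos}
    (hi : a' i = .active p') (hj : a' j = .passive k r' q) (hg : grp s i = grp s j) :
    r + 1 - offset s m i + p'.near ≤ r' - offset s m k + m + 1 ∧ Informed t i k q p' := by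
  have hn := (A.next hi).2
  have hv := A.valid h
  obtain ⟨hij, ⟨h1, h2 | h2⟩ | ⟨rfl, rfl, rfl, h2, h3, -⟩⟩ := A.passive_cases h hj
  · obtain ⟨n1, n2⟩ := h.nearActive A.pos h1 hij hg
    obtain ⟨e1, e2, -⟩ := next_near_of_not_addressed h2 hij hg hn n2 (h.passive h1).1.1
    exact ⟨by linarith, e2⟩
  · rw [hi] at h2; cases h2
  · obtain ⟨e1, e2⟩ := h2.next_near H.m_pos (l := k) hv hg hn p.label_startAfter
    exact ⟨by linarith, e2⟩

/-- What the work done so far is bounded by, if the active process performs a unit of work. -/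
theorem work_step (H : Params n t s m) (h : Invariant n s m r a W M)
    (A : ActiveRound s m r a a' i p W W' M M') (hp : p.IsWork) {l k : Fin t} {r' : ℤ} {q : Pos}
    (hl : a l = .passive k r' q) (hil : i < l) :
    W + 1 + q.works m t ≤ n + m * l + (grp s l - 1) * (s * m) := by
  have h1 := h.work A.live
  have h2 := (h.passive hl).1.works
  have hgil := grp_mono (s := s) (show (i : ℕ) ≤ l from hil.le)
  have hml : (m * (i + 1) : ℤ) ≤ m * l := mul_le_mul_of_nonneg_left (by omega) (by omega)
  rw [h2]
  match p, hp, A, h1 with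
  | .unit c (u + 1), hp, A, h1 =>
    simp only [Pos.works] at h1
    push_cast at h1
    -- A process of a later group knows of a subchunk at most `s` before `c`; a later member of the
    -- own group knows of subchunk `c - 1`.
    rcases hgil.lt_or_eq with hg | hg
    · have h3 : c ≤ s * ceilQuot s c := (ceilQuot_spec (c := c) H.s_pos).1
      have h4 := (h.far A.live hl hg).2.2.1
      simp only [Pos.nextLabel] at h4
      have h5 : ((t - q.label) * m : ℤ) ≤ (t - c + s) * m :=
        mul_le_mul_of_nonneg_right (by omega) (by omega)
      have h6 : ((grp s i - 1 + 1) * (s * m) : ℤ) ≤ (grp s l - 1) * (s * m) :=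
        mul_le_mul_of_nonneg_right (by omega) (by positivity)
      linarith
    · obtain ⟨-, h3, h4⟩ := h.nearActive A.pos hl hil hg
      have h5 : ((t - q.label) * m : ℤ) = (t - c + 1) * m := by rw [← h4]; push_cast; ring
      rw [← hg, h5]
      linarith

/-- A unit of work is still left to the active process, so the clause `work` leaves room for it: n +
m·t + s·(s·m) = 3n. -/
theorem work_le_step (H : Params n t s m) (h : Invariant n s m r a W M)
    (A : ActiveRound s m r a a' i p W W' M M') : W' ≤ 3 * n := by
  obtain ⟨hp, rfl, -⟩ | ⟨-, rfl, -⟩ := A.count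
  · have h1 := h.work A.live
    have h2 : 1 ≤ p.works m t := by
      have hv := A.valid h
      match p, hp, hv with
      | .unit c (u + 1), hp, hv =>
        have : (0 : ℤ) ≤ (t - c) * m := mul_nonneg (by have := hv.1; omega) (by omega)
        simp only [Pos.works]; push_cast; linarith
    have h3 : (m * i : ℤ) ≤ m * t := mul_le_mul_of_nonneg_left (by have := i.2; omega) (by omega)
    have h4 : ((grp s i - 1) * (s * m) : ℤ) ≤ s * (s * m) :=
      mul_le_mul_of_nonneg_right (by have := grp_le H i; omega) (by positivity)
    have h5 : (s * (s * m) : ℤ) = t * m := by rw [← mul_assoc]; exact_mod_cast congrArg (· * m) H.sq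
    have h6 : (n : ℤ) = t * m := by exact_mod_cast H.mul
    linarith
  · exact h.work_le

theorem M_le (A : ActiveRound s m r a a' i p W W' M M') : M' ≤ M + s := by
  obtain ⟨-, -, h⟩ | ⟨-, -, -, h⟩ := A.count
  · rw [h]; omega
  · exact h

theorem next_count (H : Params n t s m) (h : Invariant n s m r a W M)
    (A : ActiveRound s m r a a' i p W W' M M') {p' : Pos} (hi : a' i = .active p') :
    W' + p'.works m t = W + p.works m t ∧
    M' + s * p'.sends s t (grp s i) ≤ M + s * p.sends s t (grp s i) ∧
    p'.works m t + p'.sends s t (grp s i) = p.works m t + p.sends s t (grp s i) - 1 := by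
  obtain ⟨⟨c, u, rfl⟩, h1, h2⟩ | ⟨h0, h1, h2⟩ :=
    Pos.next_count H.s_pos (grp_le H i) (A.valid h) (A.next hi).2
  · obtain ⟨-, h3, h4⟩ | ⟨h3, -⟩ := A.count
    · rw [h1, h2, h3, h4]; exact ⟨by ring, le_rfl, by ring⟩
    · exact absurd trivial h3
  · obtain ⟨h3, -⟩ | ⟨-, h3, -, h4⟩ := A.count
    · match p, h3, h0 with
      | .unit c (u + 1), _, h0 => exact absurd rfl (h0 c u)
    · rw [h1, h2, h3]; exact ⟨rfl, by linarith, by ring⟩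

theorem msgNear_step (H : Params n t s m) (h : Invariant n s m r a W M)
    (A : ActiveRound s m r a a' i p W W' M M') {l k : Fin t} {r' : ℤ} {p' q : Pos}
    (hi : a' i = .active p') (hl : a' l = .passive k r' q) (hg : grp s i = grp s l) :
    M' + s * q.sends s t (grp s l) ≤ budget t s i + extra s p' := by
  have hv := A.valid h
  have hn := (A.next hi).2
  have hM := A.M_le
  obtain ⟨hil, ⟨h1, h2 | h2⟩ | ⟨rfl, rfl, rfl, h2, h3, -⟩⟩ := A.passive_cases h hl
  · have h3 := h.msgNear A.pos h1 hil hg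
    obtain ⟨-, -, ⟨e3, e4⟩ | e3⟩ := next_near_of_not_addressed h2 hil hg hn
      (h.nearActive A.pos h1 hil hg).2 (h.passive h1).1.1
    · obtain ⟨-, -, h4⟩ | ⟨h4, -⟩ := A.count
      · rw [h4, e4]; exact h3
      · exact absurd e3 h4
    · rw [e3]; linarith
  · rw [hi] at h2; cases h2
  · obtain ⟨-, e⟩ | ⟨e, -⟩ := h2.sends_startAfter H hv
    · rw [e]
      have := h.msgActive A.pos
      have : (s : ℤ) ≤ extra s p' := by
        cases p' <;> simp only [extra] <;> omega
      linarith
    · omega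

/-- The budget of `x` has to cover a crash of `i` in this very round. In the own group this costs
`extra`, at most `2 * s`, plus the `s` messages of the round; in a later group, `s` plus `3 * t`. -/
theorem msgPassive_step (H : Params n t s m) (h : Invariant n s m r a W M)
    (A : ActiveRound s m r a a' i p W W' M M') {x l k : Fin t} {r' : ℤ} {q : Pos}
    (hix : i < x) (hl : a' l = .passive k r' q) (hg : grp s x = grp s l) :
    M' + s * q.sends s t (grp s l) ≤ budget t s x := by
  have hv := A.valid h
  have hM := A.M_le
  have hA := h.msgActive A.pos
  obtain ⟨b1, b2⟩ := budget_succ (t := t) (s := s) (show (i : ℕ) < x from hix)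
  have hgix := grp_mono (s := s) (show (i : ℕ) ≤ x from hix.le)
  obtain ⟨hil, ⟨h1, -⟩ | ⟨rfl, rfl, rfl, h2, h3, -⟩⟩ := A.passive_cases h hl
  · rcases hgix.lt_or_eq with hg' | hg'
    · obtain ⟨e1, e2, e3⟩ := A.start_far h h1 (hg ▸ hg')
      have h4 := sends_le_of_far H (hg ▸ hg') (grp_le H l) e3 e2 hv
        (h.far A.live h1 (hg ▸ hg')).2.2.1
      rw [← e1] at h4
      have h5 : (s * q.sends s t (grp s l) : ℤ) ≤ s * (p.sends s t (grp s i) + 3 * s) :=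
        mul_le_mul_of_nonneg_left h4 (by omega)
      have h6 : (s * s : ℤ) = t := by exact_mod_cast H.sq
      have := b2 hg'
      linarith
    · have h3 := h.msgNear A.pos h1 hil (hg'.trans hg)
      have : extra s p ≤ 2 * s := by cases p <;> simp only [extra] <;> omega
      linarith
  · obtain ⟨-, e⟩ | ⟨-, e⟩ := h2.sends_startAfter H hv
    · rw [e]; linarith
    · have : (s * p.startAfter.sends s t (grp s l) : ℤ) ≤ s * (p.sends s t (grp s k) - 1) :=
        mul_le_mul_of_nonneg_left e (by omega)
      linarith

theorem invariant (H : Params n t s m) (h : Invariant n s m r a W M)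
    (A : ActiveRound s m r a a' i p W W' M M') : Invariant n s m (r + 1) a' W' M' where
  passive := A.passive_step H h
  active := by
    intro l p' hl
    obtain ⟨rfl, hn⟩ := A.next hl
    exact Pos.next_valid H (A.valid h) hn
  low := by
    intro x p' hx l hl
    obtain rfl := A.active_eq hx
    exact A.retired (h.low A.pos l hl)
  sender := by
    intro j k r' x hj
    have hpas : ∀ {q k' r'' p'}, a' q = .passive k' r'' p' → i < q ∧
        ∃ k0 r0 p0, a q = .passive k0 r0 p0 := by
      intro q k' r'' p' hq
      obtain ⟨hiq, ⟨h1, -⟩ | ⟨-, -, -, -, -, h1⟩⟩ := A.passive_cases h hq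
      · exact ⟨hiq, _, _, _, h1⟩
      · exact ⟨hiq, h1⟩
    obtain ⟨hij, ⟨h1, -⟩ | ⟨rfl, rfl, rfl, -⟩⟩ := A.passive_cases h hj
    · obtain ⟨h2, h3⟩ := h.sender h1
      refine ⟨fun l hl => A.retired (h2 l hl), fun k' r'' p' hk => ?_⟩
      obtain ⟨-, k0, r0, p0, h4⟩ := hpas hk
      exact h3 _ _ _ h4
    · exact ⟨fun l hl => A.retired (h.low A.pos l hl),
        fun k' r'' p' hk => lt_irrefl _ (hpas hk).1⟩
  far := by
    rintro l j v p' k r' q (⟨k', r'', hl, rfl⟩ | ⟨hl, rfl⟩) hj hg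
    · obtain ⟨hil, ⟨h1, -⟩ | ⟨rfl, rfl, rfl, h2, h3, -⟩⟩ := A.passive_cases h hl
      · obtain ⟨hij, ⟨h4, -⟩ | ⟨rfl, rfl, rfl, h5, h6, -⟩⟩ := A.passive_cases h hj
        · exact h.far (Or.inl ⟨_, _, h1, rfl⟩) h4 hg
        · exact A.far_old_new H h h1 hil h5 h6 hg
      · obtain ⟨hij, ⟨h4, -⟩ | ⟨rfl, rfl, rfl, h5, h6, -⟩⟩ := A.passive_cases h hj
        · exact A.far_new_old H h h2 h4 hg
        · exact absurd (h2.grp_eq h5) hg.ne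
    · obtain rfl := A.active_eq hl
      exact A.far_self H h hl hj hg
  nearPassive := by
    intro l j k r' x k' r'' q hl hj hlj hg
    have hil := (A.passive_cases h hl).1
    obtain ⟨hij, ⟨h4, -⟩ | ⟨rfl, rfl, rfl, h5, h6, -⟩⟩ := A.passive_cases h hj
    · exact A.not_polled H h h4 hlj.le hg hil
    · have := offset_lt (m := m) H.s_pos hil
      linarith
  nearActive := by
    intro l j p' k r' q hl hj hlj hg
    obtain rfl := A.active_eq hl
    exact A.near_step H h hl hj hg
  work := by
    rintro l v p' (⟨k', r'', hl, rfl⟩ | ⟨hl, rfl⟩)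
    · obtain ⟨hil, ⟨h1, -⟩ | ⟨rfl, rfl, rfl, h2, h3, -⟩⟩ := A.passive_cases h hl
      · obtain ⟨hp, rfl, -⟩ | ⟨-, rfl, -⟩ := A.count
        · exact A.work_step H h hp h1 hil
        · exact h.work (Or.inl ⟨_, _, h1, rfl⟩)
      · obtain ⟨hp, -⟩ | ⟨-, rfl, -⟩ := A.count
        · exact absurd hp h2.not_isWork
        · have h4 := h.work A.live
          rw [h2.works_startAfter]
          have h5 : (m * k' : ℤ) ≤ m * l :=
            mul_le_mul_of_nonneg_left (by have : (k' : ℕ) < l := hil; omega) (by omega)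
          have h6 : ((grp s k' - 1) * (s * m) : ℤ) ≤ (grp s l - 1) * (s * m) :=
            mul_le_mul_of_nonneg_right (by have := h2.grp_le (A.valid h); omega) (by positivity)
          linarith
    · obtain rfl := A.active_eq hl
      have := h.work A.live
      have := (A.next_count H h hl).1
      linarith
  work_le := A.work_le_step H h
  msgActive := by
    intro l p' hl
    obtain rfl := A.active_eq hl
    have := h.msgActive A.pos
    have := (A.next_count H h hl).2.1
    linarith
  msgNear := by
    intro x l p' k r' q hx hl hxl hg
    obtain rfl := A.active_eq hx
    exact A.msgNear_step H h hx hl hg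
  msgPassive := by
    intro x l k r' p' k' r'' q hx hl hxl hg
    exact A.msgPassive_step H h (A.passive_cases h hx).1 hl hg
  msg_le := by
    obtain ⟨-, -, h1⟩ | ⟨-, -, -, h1⟩ := A.count
    · rw [h1]; exact h.msg_le
    -- The broadcast of this round is still among the `sends`, so it is already paid for.
    · have h2 := h.msgActive A.pos
      have h3 : (s * 1 : ℤ) ≤ s * p.sends s t (grp s i) :=
        mul_le_mul_of_nonneg_left (Pos.sends_pos H (grp_le H i) (A.valid h)) (by omega)
      have := budget_le H i
      linarith
  time := by
    rintro l v p' (⟨k', r'', hl, rfl⟩ | ⟨hl, rfl⟩)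
    · obtain ⟨hil, ⟨h1, -⟩ | ⟨rfl, rfl, rfl, h2, h3, -⟩⟩ := A.passive_cases h hl
      · exact h.time (Or.inl ⟨_, _, h1, rfl⟩)
      -- A recipient inherits the virtual time of the sender and has no more left to do.
      · have h4 := h.time A.live
        rw [h2.works_startAfter]
        obtain ⟨-, e⟩ | ⟨-, e⟩ := h2.sends_startAfter H (A.valid h) <;> linarith
    · obtain rfl := A.active_eq hl
      have := h.time A.live
      have := (A.next_count H h hl).2.2
      linarith

end ActiveRound
end ProtocolB

namespace ProtocolB

variable {n t s m : ℕ}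

/-! ### The protocol constants in terms of √t and n/t -/

namespace Params

theorem t_pos (H : Params n t s m) : 0 < t := by
  rw [← H.sq]; exact Nat.mul_pos H.s_pos H.s_pos

theorem sqrt_eq (H : Params n t s m) : Nat.sqrt t = s := by
  rw [← H.sq, Nat.sqrt_eq]

theorem div_eq (H : Params n t s m) : n / t = m := by
  rw [H.mul, Nat.mul_div_cancel_left _ H.t_pos]

theorem div_sqrt_eq (H : Params n t s m) : n / Nat.sqrt t = s * m := by
  rw [H.sqrt_eq, H.mul, ← H.sq, Nat.mul_assoc, Nat.mul_div_cancel_left _ H.s_pos]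

theorem group_eq (H : Params n t s m) (j : ℕ) : group t j = grp s j := by
  unfold group grp; rw [H.sqrt_eq]

theorem PTO_eq (H : Params n t s m) : PTO n t = m + 2 := by
  unfold PTO; rw [H.div_eq]

theorem GTO_eq (H : Params n t s m) (k : ℕ) :
    (GTO n t k : ℤ) = groupSlack s m + 1 + (s - 1) * (m + 2) - (k % s : ℕ) * (m + 2) := by
  have h : k % s + 1 ≤ s := Nat.mod_lt k H.s_pos
  unfold GTO pos groupSlack
  rw [H.div_sqrt_eq, H.sqrt_eq, H.PTO_eq, Nat.sub_sub]
  push_cast [Nat.cast_sub h]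
  ring

end Params

/-! ### Time outs -/

theorem firstPolled_le_iff (H : Params n t s m) {j k x : ℕ} (hk : k < j) (hx : x ≤ j) :
    firstPolled t j k ≤ x ↔ k < x ∧ grp s x = grp s j := by
  unfold firstPolled
  rw [H.group_eq, H.group_eq, H.sqrt_eq]
  have hs := H.s_pos
  have hkj := grp_mono (s := s) hk.le
  split_ifs with h
  · have e : (grp s j - 1) * s ≤ x ↔ j / s ≤ x / s := by
      rw [show grp s j - 1 = j / s from rfl, Nat.le_div_iff_mul_le hs]
    rw [e]
    constructor
    · intro h1
      have h2 : grp s x = grp s j := le_antisymm (grp_mono hx) (Nat.succ_le_succ h1)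
      exact ⟨lt_of_grp_lt (s := s) (by omega), h2⟩
    · rintro ⟨-, h2⟩
      exact (Nat.succ_injective h2).ge
  · rw [not_not] at h
    constructor
    · intro h1
      exact ⟨h1, le_antisymm (grp_mono hx) (h ▸ grp_mono (by omega))⟩
    · exact fun h1 => h1.1

/-- Inside a group both sides advance by one `PTO` per process. Across groups, `GTO n t k` is `GTO n
t 0` minus one `PTO` for each position before `k` in its group, so the sum in `DD` telescopes. -/
theorem timeout_eq (H : Params n t s m) {j k x : ℕ} (r' : ℕ) (hkx : k < x) (hx : x ≤ j)
    (hg : grp s x = grp s j) :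
    ((r' + DD n t j k + (x - firstPolled t j k) * PTO n t : ℕ) : ℤ) =
      r' - offset s m k + offset s m x := by
  have hle := (firstPolled_le_iff H (hkx.trans_le hx) hx).2 ⟨hkx, hg⟩
  rw [Nat.cast_add, Nat.cast_add, Nat.cast_mul, Nat.cast_sub hle]
  unfold DD firstPolled
  rw [H.group_eq, H.group_eq, H.sqrt_eq, H.PTO_eq]
  by_cases h : grp s k = grp s j
  · have := offset_grp_eq (m := m) (h.trans hg.symm)
    simp only [h, ne_eq, not_true_eq_false, if_false]
    push_cast
    linarith
  · have hkj : grp s k < grp s j :=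
      lt_of_le_of_ne (grp_mono (hkx.trans_le hx).le) h
    simp only [h, Ne.symm h, ne_eq, not_false_eq_true, if_true]
    have h1 := Nat.div_add_mod x s
    have h2 : x / s = grp s j - 1 := by rw [← hg]; rfl
    have h3 : (((grp s j - 1) * s : ℕ) : ℤ) = x - (x % s : ℕ) := by
      rw [h2, Nat.mul_comm] at h1
      rw [eq_sub_iff_add_eq]; exact_mod_cast h1
    rw [Nat.sub_sub]
    have h4 := H.GTO_eq 0
    rw [Nat.zero_mod, Nat.cast_zero, zero_mul, sub_zero] at h4
    rw [Nat.cast_add, Nat.cast_mul, Nat.cast_sub (show grp s k + 1 ≤ grp s j from hkj), h3, h4,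
      H.GTO_eq]
    unfold offset
    rw [hg]
    push_cast
    ring

theorem operation_passive (H : Params n t s m) {r r' : ℕ} {j k : Fin t} {msg : Ordinary}
    (hk : k < j) {o : Op t} (ho : operation n r j (.passive k msg r') = some o) :
    ∃ x : Fin t, k < x ∧ x < j ∧ grp s x = grp s j ∧ r' - offset s m k + offset s m x = r ∧
      o = .send .goAhead {x} := by
  simp only [operation] at ho
  split_ifs at ho with h1 h2
  cases ho
  obtain ⟨h3, d, h4⟩ := h1
  have hP : 0 < PTO n t := by rw [H.PTO_eq]; omega
  have h5 : (r - (r' + DD n t j k)) / PTO n t = d := by rw [h4, Nat.mul_div_cancel_left _ hP]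
  have h6 := (firstPolled_le_iff H (x := firstPolled t j k + (r - (r' + DD n t j k)) / PTO n t)
    (show (k : ℕ) < j from hk) h2.le).1 (Nat.le_add_right _ _)
  refine ⟨⟨_, h2.trans j.2⟩, h6.1, h2, h6.2, ?_, rfl⟩
  rw [← timeout_eq H r' h6.1 h2.le h6.2, h5, Nat.add_sub_cancel_left, Nat.mul_comm, ← h4]
  congr 1
  omega

theorem operation_of_poll (H : Params n t s m) {r r' : ℕ} {j k x : Fin t} (msg : Ordinary)
    (hk : k < x) (hx : x < j) (hg : grp s x = grp s j)
    (hr : r' - offset s m k + offset s m x = r) :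
    operation n r j (.passive k msg r') = some (.send .goAhead {x}) := by
  have hle := (firstPolled_le_iff H (show (k : ℕ) < j from hk.trans hx)
    (show (x : ℕ) ≤ j from hx.le)).2 ⟨hk, hg⟩
  rw [← timeout_eq H r' hk (show (x : ℕ) ≤ j from hx.le) hg] at hr
  have hr' := Int.ofNat.inj hr
  have hP : 0 < PTO n t := by rw [H.PTO_eq]; omega
  have e : r - (r' + DD n t j k) = (x - firstPolled t j k) * PTO n t := by omega
  simp only [operation, e, Nat.mul_div_cancel _ hP, Nat.add_sub_cancel' hle]
  rw [if_pos ⟨by omega, Dvd.intro_left _ rfl⟩, dif_pos (show (x : ℕ) < j from hx)]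

theorem wake_passive (H : Params n t s m) {r r' : ℕ} {j k : Fin t} (msg : Ordinary) (hk : k < j) :
    wake n r j (.passive k msg r') =
      if r' - offset s m k + offset s m j = r then .active (doWork n j k msg)
      else .passive k msg r' := by
  rw [← timeout_eq H r' (show (k : ℕ) < j from hk) le_rfl rfl]
  simp only [wake, Nat.cast_inj, eq_comm]

/-! ### Code -/

/-- The next operation of process `j` in a position. -/
def Pos.op (n : ℕ) {t : ℕ} (j : Fin t) : Pos → Op t
  | unit c 0 => .send (.ordinary (.subchunk c)) (remainder j)
  | unit c (u + 1) => .work (c * (n / t) + 1 - (u + 1))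
  | inform c h => .send (.ordinary (.chunk c h)) (members t h)
  | report c h => .send (.ordinary (.chunk c h)) (remainder j)

/-- The operations of process `j` from a position on. -/
def Pos.code (n : ℕ) {t : ℕ} (j : Fin t) : Pos → List (Op t)
  | unit c u => (List.range' (c * (n / t) + 1 - u) u).map .work ++ partialCheckpoint j c ++
      (if Nat.sqrt t ∣ c then fullCheckpoint j c (group t j + 1) else []) ++ continueWork n j c
  | inform c h => fullCheckpoint j c h ++ continueWork n j c
  | report c h => .send (.ordinary (.chunk c h)) (remainder j) ::
      (fullCheckpoint j c (h + 1) ++ continueWork n j c)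

theorem continueWork_eq (H : Params n t s m) (j : Fin t) (c : ℕ) :
    continueWork n j c = if c < t then (Pos.unit (c + 1) m).code n j else [] := by
  split_ifs with h
  · obtain rfl := H.div_eq
    have e : t - c = (t - (c + 1)) + 1 := by omega
    have e2 : (c + 1) * (n / t) + 1 - n / t = c * (n / t) + 1 := by
      rw [Nat.add_mul]; omega
    unfold continueWork
    rw [e, List.range'_succ, List.flatMap_cons]
    simp only [Pos.code, e2, performSubchunk, Nat.add_sub_cancel, List.append_assoc, continueWork]
  · rw [continueWork, show t - c = 0 by omega]; rfl

theorem afterChunk_code (H : Params n t s m) (j : Fin t) {c h : ℕ} (hh : h ≤ s + 1) :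
    fullCheckpoint j c h ++ continueWork n j c =
      (Pos.afterChunk s m t c h).elim [] (Pos.code n j) := by
  unfold Pos.afterChunk
  split_ifs with h1 h2
  · rfl
  · rw [fullCheckpoint, H.sqrt_eq, show s + 1 - h = 0 by omega, continueWork_eq H, if_pos h2]; rfl
  · rw [fullCheckpoint, H.sqrt_eq, show s + 1 - h = 0 by omega, continueWork_eq H, if_neg h2]; rfl

/-- This identifies the operation lists with runs of `Pos.next`, so that the list in an active state
can be replaced by a position. -/
theorem code_eq (H : Params n t s m) {j : Fin t} {p : Pos} (hp : p.Valid s m t (grp s j)) :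
    p.code n j = p.op n j :: (p.next s m t (grp s j)).elim [] (Pos.code n j) := by
  have hj := grp_le H j
  match p, hp with
  | .unit c 0, hp =>
    simp only [Pos.code, Pos.op, Pos.next, H.sqrt_eq, H.group_eq, partialCheckpoint]
    split_ifs with hd
    · rw [← afterChunk_code H j (by omega)]; simp
    · have : c < t := lt_of_le_of_ne hp.1 (fun h => hd (h ▸ ⟨s, H.sq.symm⟩))
      rw [continueWork_eq H, if_pos this]; simp
  | .unit c (u + 1), ⟨h1, h2, h3⟩ =>
    obtain rfl := H.div_eq
    have h4 : 1 * (n / t) ≤ c * (n / t) := Nat.mul_le_mul_right _ (h3 (by omega))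
    have e : c * (n / t) + 1 - (u + 1) + 1 = c * (n / t) + 1 - u := by omega
    simp only [Pos.code, Pos.op, Pos.next, List.range'_succ, e, Option.elim_some, List.map_cons,
      List.cons_append]
  | .inform c h, ⟨h1, h2, h3, h4⟩ =>
    simp only [Pos.code, Pos.op, Pos.next, fullCheckpoint, H.sqrt_eq]
    rw [show s + 1 - h = (s + 1 - (h + 1)) + 1 by omega, List.range'_succ, List.flatMap_cons]
    simp only [Option.elim, Pos.code, fullCheckpoint, H.sqrt_eq]
    rfl
  | .report c h, ⟨h1, h2, h3, h4⟩ =>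
    simp only [Pos.code, Pos.op, Pos.next]
    rw [afterChunk_code H j (by omega)]

theorem mem_remainder (H : Params n t s m) {i q : Fin t} :
    q ∈ remainder i ↔ i < q ∧ grp s q = grp s i := by
  simp [remainder, H.group_eq]

theorem mem_members (H : Params n t s m) {h : ℕ} {q : Fin t} :
    q ∈ members t h ↔ grp s q = h := by
  simp [members, H.group_eq]

theorem card_members_le (H : Params n t s m) (h : ℕ) : (members t h).card ≤ s := by
  have hs := H.s_pos
  rw [← Nat.card_Ico ((h - 1) * s) ((h - 1) * s + s) |>.trans (Nat.add_sub_cancel_left ..)]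
  refine Finset.card_le_card_of_injOn (fun q : Fin t => (q : ℕ)) ?_ (Fin.val_injective.injOn)
  intro q hq
  have h1 : (q : ℕ) / s + 1 = h := (mem_members H).1 hq
  have h2 := Nat.div_add_mod q s
  have h3 := Nat.mod_lt q hs
  rw [show (q : ℕ) / s = h - 1 by rw [← h1, Nat.add_sub_cancel], Nat.mul_comm] at h2
  generalize (h - 1) * s = y at *
  generalize (q : ℕ) % s = z at *
  have : y ≤ q ∧ (q : ℕ) < y + s := ⟨by omega, by omega⟩
  simpa using this

theorem card_remainder_le (H : Params n t s m) (i : Fin t) : (remainder i).card ≤ s := by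
  refine (Finset.card_le_card ?_).trans (card_members_le H (grp s i))
  intro q hq
  exact (mem_members H).2 ((mem_remainder H).1 hq).2

/-- The operation in a position is a unit of work or an ordinary broadcast. -/
theorem op_cases (H : Params n t s m) (i : Fin t) (p : Pos) :
    (p.IsWork ∧ ∃ u, p.op n i = .work u) ∨
    (¬ p.IsWork ∧ ∃ msg S, p.op n i = .send (.ordinary msg) S ∧ S.card ≤ s ∧
      ∀ q, q ∈ S ↔ Addressed s i q p) := by
  match p with
  | .unit c 0 =>
    exact Or.inr ⟨id, _, _, rfl, card_remainder_le H i, fun q => mem_remainder H⟩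
  | .unit c (u + 1) => exact Or.inl ⟨trivial, _, rfl⟩
  | .inform c h =>
    exact Or.inr ⟨id, _, _, rfl, card_members_le H h, fun q => mem_members H⟩
  | .report c h =>
    exact Or.inr ⟨id, _, _, rfl, card_remainder_le H i, fun q => mem_remainder H⟩

/-- A report `(t, h)` may carry the number of another group and then terminates nobody, hence the
last hypothesis. -/
theorem isFinal_of_addressed (H : Params n t s m) {i q : Fin t} {p : Pos} {msg : Ordinary}
    {S : Finset (Fin t)} (hop : p.op n i = .send (.ordinary msg) S) (h : Addressed s i q p)
    (hl : p.label = t) (hp : p.label < t ∨ ∀ c h, p ≠ .report c h) : IsFinal q msg := by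
  match p, hop, h with
  | .unit c 0, hop, h => cases hop; exact Or.inl (congrArg _ hl)
  | .inform c k, hop, h =>
    cases hop
    have hl : c = t := hl
    have h : grp s q = k := h
    exact Or.inr (by rw [H.group_eq, hl, h])
  | .report c k, hop, h =>
    obtain hp | hp := hp
    · omega
    · exact absurd rfl (hp c k)

/-- The justification of `startAfter`. After `(c, h)` from another group, `doWork` makes a full
checkpoint unconditionally; `unit c 0` does so too, because `s ∣ c`. -/
theorem doWork_of_addressed (H : Params n t s m) {i q : Fin t} {p : Pos} {msg : Ordinary}
    {S : Finset (Fin t)} (hop : p.op n i = .send (.ordinary msg) S) (h : Addressed s i q p)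
    (hp : p.Valid s m t (grp s i)) : doWork n q i msg = p.startAfter.code n q := by
  match p, hop, h, hp with
  | .unit c 0, hop, h, hp => cases hop; rfl
  | .inform c k, hop, h, hp =>
    cases hop; cases h
    have h1 : group t i ≠ group t q := by rw [H.group_eq, H.group_eq]; exact hp.2.2.1.ne
    have h2 : Nat.sqrt t ∣ c := by rw [H.sqrt_eq]; exact hp.2.1
    simp [doWork, Pos.startAfter, Pos.code, h1, h2]
  | .report c k, hop, h, hp =>
    cases hop
    have h1 : group t i = group t q := by rw [H.group_eq, H.group_eq]; exact h.2.symm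
    simp [doWork, Pos.startAfter, Pos.code, h1]

end ProtocolB

namespace ProtocolB

variable {n t s m : ℕ} {F : FailurePattern t} {a a' : Fin t → View t} {W W' M M' : ℤ}

/-! ### States and their views -/

/-- `v` is the view of the state of process `l`. -/
inductive Represents (n : ℕ) {t : ℕ} (l : Fin t) : State t → View t → Prop
  | passive (k msg) (r : ℕ) (p) (h : doWork n l k msg = p.code n l) :
      Represents n l (.passive k msg r) (.passive k r p)
  | active (p) : Represents n l (.active (p.code n l)) (.active p)
  | terminated : Represents n l .terminated .retired
  | crashed : Represents n l .crashed .retired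

namespace Represents

variable {l : Fin t} {σ : State t}

theorem of_passive {k : Fin t} {r' : ℤ} {p : Pos} (h : Represents n l σ (.passive k r' p)) :
    ∃ (msg : Ordinary) (r : ℕ), σ = .passive k msg r ∧ r' = r ∧
      doWork n l k msg = p.code n l := by
  generalize hv : View.passive k r' p = v at h
  cases h <;> cases hv
  exact ⟨_, _, rfl, rfl, by assumption⟩

theorem of_active {p : Pos} (h : Represents n l σ (.active p)) : σ = .active (p.code n l) := by
  generalize hv : View.active p = v at h
  cases h <;> cases hv
  rfl

theorem of_retired (h : Represents n l σ .retired) : σ = .terminated ∨ σ = .crashed := by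
  generalize hv : View.retired = v at h
  cases h <;> cases hv
  · exact Or.inl rfl
  · exact Or.inr rfl

theorem exists_active {v : View t} (h : Represents n l σ v) (hσ : σ.IsActive) :
    ∃ p, v = .active p := by
  cases h
  · exact hσ.elim
  · exact ⟨_, rfl⟩
  · exact hσ.elim
  · exact hσ.elim

theorem eq_retired {v : View t} (h : Represents n l .crashed v) : v = .retired := by
  cases h; rfl

theorem retired {v : View t} (h : Represents n l σ v) (hv : v = .retired) : σ.Retired := by
  subst hv
  obtain rfl | rfl := h.of_retired <;> trivial

end Represents

/-! ### The beginning of a round -/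

/-- The view of a process after a possible time out. -/
def wakeView (s m : ℕ) {t : ℕ} (r : ℤ) (l : Fin t) : View t → View t
  | .passive k r' p =>
      if r' - offset s m k + offset s m l = r then .active p else .passive k r' p
  | v => v

theorem wakeView_eq_passive {r : ℤ} {l k : Fin t} {v : View t} {r' : ℤ} {p : Pos}
    (h : wakeView s m r l v = .passive k r' p) :
    v = .passive k r' p ∧ r' - offset s m k + offset s m l ≠ r := by
  cases v with
  | passive k r' p =>
    simp only [wakeView] at h
    split_ifs at h with h1
    cases h
    exact ⟨rfl, h1⟩
  | active p => cases h
  | retired => cases h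

theorem wakeView_eq_active {r : ℤ} {l : Fin t} {v : View t} {p : Pos}
    (h : wakeView s m r l v = .active p) :
    v = .active p ∨ ∃ k r', v = .passive k r' p ∧ r' - offset s m k + offset s m l = r := by
  cases v with
  | passive k r' p =>
    simp only [wakeView] at h
    split_ifs at h with h1
    cases h
    exact Or.inr ⟨_, _, rfl, h1⟩
  | active p => exact Or.inl h
  | retired => cases h

theorem wakeView_eq_retired {r : ℤ} {l : Fin t} {v : View t}
    (h : wakeView s m r l v = .retired) : v = .retired := by
  cases v with
  | passive k r' p =>
    simp only [wakeView] at h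
    split_ifs at h with h1
  | active p => cases h
  | retired => rfl

theorem Represents.wake (H : Params n t s m) {r : ℕ} {l : Fin t} {σ : State t} {v : View t}
    (h : Represents n l σ v) (hk : ∀ {k r' p}, v = .passive k r' p → k < l) :
    Represents n l (wake n r l σ) (wakeView s m r l v) := by
  cases h with
  | passive k msg r' p h =>
    rw [wake_passive H msg (hk rfl)]
    simp only [wakeView]
    split_ifs
    · rw [h]; exact .active p
    · exact .passive _ _ _ _ h
  | active p => exact .active p
  | terminated => exact .terminated
  | crashed => exact .crashed

/-- No passive process is due to become active. -/
def Awake (s m : ℕ) {t : ℕ} (r : ℤ) (a : Fin t → View t) : Prop :=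
  ∀ {l k r' q}, a l = .passive k r' q → r < r' - offset s m k + offset s m l

theorem Invariant.wake (H : Params n t s m) {r : ℤ} (h : Invariant n s m r a W M) :
    Invariant n s m r (fun l => wakeView s m r l (a l)) W M ∧
      Awake s m r fun l => wakeView s m r l (a l) := by
  refine ⟨h.activate H le_rfl (by linarith) ?_ ?_ ?_ ?_, ?_⟩
  · intro l hl
    simp only [hl, wakeView]
  · intro l k r' p hl
    have hl := (wakeView_eq_passive hl).1
    exact ⟨hl, (h.passive hl).2.2⟩
  · intro l j k r' p k' r'' q hl hj
    exact h.nearPassive (wakeView_eq_passive hl).1 (wakeView_eq_passive hj).1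
  · intro l p hl
    obtain h1 | ⟨k, r', h1, h2⟩ := wakeView_eq_active hl
    · exact Or.inl ⟨h1, rfl⟩
    · exact Or.inr ⟨k, r', h1, h2.ge, l, k, r', p, h1, le_rfl, rfl, h2⟩
  · intro l k r' q hl
    obtain ⟨h1, h2⟩ := wakeView_eq_passive hl
    exact lt_of_le_of_ne (h.passive h1).2.2 (Ne.symm h2)

/-! ### What is done in a round -/

/-- The units of work that an operation performs. -/
def Op.works : Option (Op t) → ℕ
  | some (.work _) => 1
  | _ => 0

/-- The ordinary messages that an operation sends. -/
def Op.ordinaries : Option (Op t) → ℕ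
  | some (.send (.ordinary _) S) => S.card
  | _ => 0

/-- The "go ahead" messages that an operation sends. -/
def Op.goAheads : Option (Op t) → ℕ
  | some (.send .goAhead S) => S.card
  | _ => 0

theorem workIn_eq (n : ℕ) (F : FailurePattern t) (r : ℕ) (p : Fin t) :
    workIn n F r p = Op.works (operation n r p (stateIn n F r p)) := by
  unfold workIn Op.works
  rcases operation n r p (stateIn n F r p) with _ | _ | _ <;> rfl

theorem messagesIn_eq (n : ℕ) (F : FailurePattern t) (r : ℕ) (p : Fin t) :
    messagesIn n F r p = Op.ordinaries (operation n r p (stateIn n F r p)) +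
      Op.goAheads (operation n r p (stateIn n F r p)) := by
  unfold messagesIn Op.ordinaries Op.goAheads
  rcases operation n r p (stateIn n F r p) with _ | _ | ⟨_ | _, _⟩ <;> simp

section Round

variable {r : ℕ} {σ : Fin t → State t}

theorem operation_active (H : Params n t s m) (h : Invariant n s m r a W M)
    (hR : ∀ l, Represents n l (σ l) (a l)) {i : Fin t} {p : Pos} (hi : a i = .active p) :
    operation n r i (σ i) = some (p.op n i) := by
  rw [((hi ▸ hR i : Represents n i (σ i) (.active p))).of_active, code_eq H (h.active hi)]
  rfl

theorem operation_cases (H : Params n t s m) (h : Invariant n s m r a W M)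
    (hR : ∀ l, Represents n l (σ l) (a l)) {x : Fin t} {o : Op t}
    (ho : operation n r x (σ x) = some o) :
    (∃ p, a x = .active p ∧ o = p.op n x) ∨
    ∃ k r' q y, a x = .passive k r' q ∧ k < y ∧ y < x ∧ grp s y = grp s x ∧
      r' - offset s m k + offset s m y = r ∧ o = .send .goAhead {y} := by
  cases hv : a x with
  | passive k r' q =>
    obtain ⟨msg, r'', h1, rfl, h2⟩ := (hv ▸ hR x : Represents n x (σ x) (.passive k r' q)).of_passive
    rw [h1] at ho
    obtain ⟨y, e1, e2, e3, e4, e5⟩ := operation_passive H (h.passive hv).1.lt ho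
    exact Or.inr ⟨_, _, _, y, rfl, e1, e2, e3, e4, e5⟩
  | active p =>
    rw [operation_active H h hR hv] at ho
    cases ho
    exact Or.inl ⟨p, rfl, rfl⟩
  | retired =>
    obtain h1 | h1 := (hv ▸ hR x : Represents n x (σ x) .retired).of_retired <;>
      rw [h1] at ho <;> cases ho

theorem exists_of_received {q x : Fin t} {msg : Message}
    (h : received n F r σ q x = some msg) :
    ∃ S, operation n r x (σ x) = some (.send msg S) ∧ q ∈ S ∧
      (F.crashRound x = some r → q ∈ F.reached x) := by
  unfold received at h
  split at h
  · rename_i msg' S heq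
    split_ifs at h with h1
    cases h
    exact ⟨S, heq, h1⟩
  · cases h

theorem received_goAhead (H : Params n t s m) (h : Invariant n s m r a W M)
    (hR : ∀ l, Represents n l (σ l) (a l)) {q x : Fin t}
    (hq : received n F r σ q x = some .goAhead) :
    ∃ k r' p, a x = .passive k r' p ∧ k < q ∧ q < x ∧ grp s q = grp s x ∧
      r' - offset s m k + offset s m q = r := by
  obtain ⟨S, h1, h2, -⟩ := exists_of_received hq
  obtain ⟨p, -, h3⟩ | ⟨k, r', p, y, e1, e2, e3, e4, e5, e6⟩ := operation_cases H h hR h1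
  · obtain ⟨-, u, h4⟩ | ⟨-, msg, S', h4, -⟩ := op_cases (n := n) H x p <;>
      rw [h4] at h3 <;> cases h3
  · cases e6
    obtain rfl := Finset.mem_singleton.1 h2
    exact ⟨k, r', p, e1, e2, e3, e4, e5⟩

theorem received_ordinary (H : Params n t s m) (h : Invariant n s m r a W M)
    (hR : ∀ l, Represents n l (σ l) (a l)) {q x : Fin t} {msg : Ordinary}
    (hq : received n F r σ q x = some (.ordinary msg)) :
    ∃ p S, a x = .active p ∧ p.op n x = .send (.ordinary msg) S ∧ Addressed s x q p := by
  obtain ⟨S, h1, h2, -⟩ := exists_of_received hq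
  obtain ⟨p, hp, h3⟩ | ⟨k, r', p, y, e1, e2, e3, e4, e5, e6⟩ := operation_cases H h hR h1
  · obtain ⟨-, u, h4⟩ | ⟨-, msg', S', h4, -, h5⟩ := op_cases (n := n) H x p
    · rw [h4] at h3; cases h3
    · have h6 := h3.trans h4
      cases h6
      exact ⟨p, S, hp, h3.symm, (h5 q).1 h2⟩
  · cases e6

theorem received_of_heard {q x : Fin t} {msg : Ordinary}
    (h : heard n F r σ q = some (x, msg)) : received n F r σ q x = some (.ordinary msg) := by
  unfold heard at h
  obtain ⟨y, -, h1⟩ := List.exists_of_findSome?_eq_some h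
  split at h1
  · rename_i msg' heq
    cases h1
    exact heq
  · cases h1

theorem not_received_of_heard {q : Fin t} (h : heard n F r σ q = none) (x : Fin t)
    (msg : Ordinary) : received n F r σ q x ≠ some (.ordinary msg) := by
  unfold heard at h
  rw [List.findSome?_eq_none_iff] at h
  intro h1
  have := h x (List.mem_finRange x)
  rw [h1] at this
  cases this

/-- The configuration at the end of round `r`, if the states during it are `σ`. -/
def settle (n : ℕ) (F : FailurePattern t) (r : ℕ) (σ : Fin t → State t) (q : Fin t) : State t :=
  if F.crashRound q = some r then .crashed
  else update n r q (heard n F r σ q)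
    (decide (∃ p, received n F r σ q p = some .goAhead)) (σ q)

theorem active_unique {r : ℤ} (h : Invariant n s m r a W M) {i j : Fin t} {p q : Pos} (hi : a i = .active p)
    (hj : a j = .active q) : i = j := by
  rcases lt_trichotomy i j with hij | hij | hij
  · have := h.low hj i hij
    rw [hi] at this; cases this
  · exact hij
  · have := h.low hi j hij
    rw [hj] at this; cases this

theorem settle_self (H : Params n t s m) (h : Invariant n s m r a W M)
    (hR : ∀ l, Represents n l (σ l) (a l)) {i : Fin t} {p : Pos} (hi : a i = .active p)
    (hc : F.crashRound i ≠ some r) :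
    ∃ v, Represents n i (settle n F r σ i) v ∧
      (v = .retired ∨ ∃ p', p.next s m t (grp s i) = some p' ∧ v = .active p') := by
  have hv := h.active hi
  have h1 := (hi ▸ hR i : Represents n i (σ i) (.active p)).of_active
  rw [settle, if_neg hc, h1, code_eq H hv]
  cases hn : p.next s m t (grp s i) with
  | none => exact ⟨.retired, .terminated, Or.inl rfl⟩
  | some p' =>
    refine ⟨.active p', ?_, Or.inr ⟨p', rfl, rfl⟩⟩
    have hne : p'.code n i ≠ [] := by
      rw [code_eq H (Pos.next_valid H hv hn)]; exact List.cons_ne_nil _ _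
    have e : ∀ x ga, update n r i x ga (.active (p.op n i :: p'.code n i)) =
        .active (p'.code n i) := fun _ _ => if_neg hne
    simp only [Option.elim_some, e]
    exact .active p'

theorem settle_retired (hR : ∀ l, Represents n l (σ l) (a l)) {q : Fin t} (hq : a q = .retired) :
    Represents n q (settle n F r σ q) .retired := by
  unfold settle
  split_ifs
  · exact .crashed
  · obtain h1 | h1 := (hq ▸ hR q : Represents n q (σ q) .retired).of_retired <;> rw [h1]
    · exact .terminated
    · exact .crashed

theorem settle_other (H : Params n t s m) (h : Invariant n s m r a W M)
    (hR : ∀ l, Represents n l (σ l) (a l)) {i : Fin t} {p : Pos} (hi : a i = .active p)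
    {q k : Fin t} {r' : ℤ} {x : Pos} (hq : a q = .passive k r' x)
    (hc : F.crashRound q ≠ some r) :
    ∃ v, Represents n q (settle n F r σ q) v ∧ (v = .retired ∨
      (v = .passive k r' x ∧ (¬ Addressed s i q p ∨ F.crashRound i = some r)) ∨
      (Addressed s i q p ∧ p.label < t ∧ v = .passive i r p.startAfter)) := by
  have hv := h.active hi
  have hiq : i < q := by
    by_contra h1
    rcases (not_lt.1 h1).lt_or_eq with h2 | rfl
    · have := h.low hi q h2
      rw [hq] at this; cases this
    · rw [hi] at hq; cases hq
  -- A process that polls `q` would force all processes below `q`, including `i`, to be retired.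
  have hga : ¬ ∃ y, received n F r σ q y = some .goAhead := by
    rintro ⟨y, hy⟩
    obtain ⟨k', r'', p', e1, e2, e3, e4, e5⟩ := received_goAhead H h hR hy
    have := h.retired_of_polled H e1 e3.le e4 e5.le i hiq
    rw [hi] at this; cases this
  obtain ⟨msg, r'', h1, rfl, h2⟩ := (hq ▸ hR q : Represents n q (σ q) (.passive k r' x)).of_passive
  rw [settle, if_neg hc, h1, decide_eq_false hga]
  cases hh : heard n F r σ q with
  | none =>
    refine ⟨.passive k r'' x, .passive _ _ _ _ h2, Or.inr (Or.inl ⟨rfl, ?_⟩)⟩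
    by_contra hcon
    rw [not_or, not_not] at hcon
    obtain ⟨h3, -⟩ | ⟨-, msg', S, h3, -, h4⟩ := op_cases (n := n) H i p
    · exact hcon.1.not_isWork h3
    · apply not_received_of_heard hh i msg'
      unfold received
      rw [operation_active H h hR hi, h3]
      exact if_pos ⟨(h4 q).2 hcon.1, fun h5 => absurd h5 hcon.2⟩
  | some ym =>
    obtain ⟨y, msg'⟩ := ym
    obtain ⟨p', S, e1, e2, e3⟩ := received_ordinary H h hR (received_of_heard hh)
    obtain rfl := active_unique h hi e1
    rw [hi] at e1
    cases e1
    simp only [update]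
    by_cases hf : IsFinal q msg'
    · rw [if_pos hf]
      exact ⟨_, .terminated, Or.inl rfl⟩
    · rw [if_neg hf]
      have hlabel : p.label < t := by
        by_contra hcon
        apply hf
        -- A message with label `t` terminates `q`, unless it is a report, and `Informed` excludes
        -- that.
        refine isFinal_of_addressed H e2 e3 (le_antisymm hv.label_le (not_lt.1 hcon)) ?_
        by_contra hcon'
        push Not at hcon'
        obtain ⟨-, c, k', rfl⟩ := hcon'
        exact hcon (h.nearActive hi hq hiq e3.2.symm).2
      refine ⟨.passive i r p.startAfter, ?_, Or.inr (Or.inr ⟨e3, hlabel, rfl⟩)⟩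
      exact .passive _ _ _ _ (doWork_of_addressed H e2 e3 hv)

/-- A round with an active process. -/
theorem exists_activeRound (H : Params n t s m) (h : Invariant n s m r a W M)
    (hR : ∀ l, Represents n l (σ l) (a l)) (hA : Awake s m r a) {i : Fin t} {p : Pos}
    (hi : a i = .active p)
    (hcount : (p.IsWork ∧ W' = W + 1 ∧ M' = M) ∨ (¬ p.IsWork ∧ W' = W ∧ M ≤ M' ∧ M' ≤ M + s)) :
    ∃ a', (∀ q, Represents n q (settle n F r σ q) (a' q)) ∧
      ActiveRound s m r a a' i p W W' M M' := by
  have key : ∀ q, ∃ v, Represents n q (settle n F r σ q) v ∧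
      (q = i → v = .retired ∨ ∃ p', p.next s m t (grp s i) = some p' ∧ v = .active p') ∧
      (q ≠ i → v = .retired ∨
        (∃ k r' x, a q = .passive k r' x ∧ v = .passive k r' x ∧
          (¬ Addressed s i q p ∨ F.crashRound i = some r)) ∨
        (∃ k r' x, a q = .passive k r' x ∧ Addressed s i q p ∧ p.label < t ∧
          v = .passive i r p.startAfter)) := by
    intro q
    by_cases hc : F.crashRound q = some r
    · refine ⟨.retired, ?_, fun _ => Or.inl rfl, fun _ => Or.inl rfl⟩
      rw [settle, if_pos hc]
      exact .crashed
    · cases hq : a q with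
      | passive k r' x =>
        have hne : q ≠ i := by rintro rfl; rw [hi] at hq; cases hq
        obtain ⟨v, h1, h2⟩ := settle_other H h hR hi hq hc
        refine ⟨v, h1, fun h3 => absurd h3 hne, fun _ => ?_⟩
        obtain h2 | ⟨h2, h3⟩ | ⟨h2, h3, h4⟩ := h2
        · exact Or.inl h2
        · exact Or.inr (Or.inl ⟨_, _, _, rfl, h2, h3⟩)
        · exact Or.inr (Or.inr ⟨_, _, _, rfl, h2, h3, h4⟩)
      | active p' =>
        obtain rfl := active_unique h hi hq
        rw [hi] at hq
        cases hq
        obtain ⟨v, h1, h2⟩ := settle_self H h hR hi hc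
        exact ⟨v, h1, fun _ => h2, fun h3 => absurd rfl h3⟩
      | retired =>
        exact ⟨_, settle_retired hR hq,
          fun _ => Or.inl rfl, fun _ => Or.inl rfl⟩
  choose a' h1 h2 h3 using key
  refine ⟨a', h1, hi, hA, h2 i rfl, fun q hq => ?_, hcount⟩
  obtain h4 | ⟨k, r', x, h4, h5, h6⟩ | h4 := h3 q hq
  · exact Or.inl h4
  · refine Or.inr (Or.inl ⟨k, r', x, h4, h5, h6.imp_right fun h7 => ?_⟩)
    have := h1 i
    rw [settle, if_pos h7] at this
    exact this.eq_retired
  · exact Or.inr (Or.inr h4)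

/-- A round without an active process. -/
theorem exists_quietRound (H : Params n t s m) (h : Invariant n s m r a W M)
    (hR : ∀ l, Represents n l (σ l) (a l)) (hA : Awake s m r a) (hi : ∀ i p, a i ≠ .active p) :
    ∃ a', (∀ q, Represents n q (settle n F r σ q) (a' q)) ∧
      Invariant n s m (r + 1 : ℕ) a' W M ∧
      ∀ {l k r' q}, a' l = .passive k r' q → a l = .passive k r' q := by
  have key : ∀ q, ∃ v, Represents n q (settle n F r σ q) v ∧
      (F.crashRound q = some r → v = .retired) ∧ (a q = .retired → v = .retired) ∧
      (v = .retired ∨ ∃ k r' x, a q = .passive k r' x ∧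
        ((v = .passive k r' x ∧ ∀ y, received n F r σ q y ≠ some .goAhead) ∨
        (v = .active x ∧ ∃ y, received n F r σ q y = some .goAhead))) := by
    intro q
    by_cases hc : F.crashRound q = some r
    · refine ⟨.retired, ?_, fun _ => rfl, fun _ => rfl, Or.inl rfl⟩
      rw [settle, if_pos hc]
      exact .crashed
    · cases hq : a q with
      | passive k r' x =>
        obtain ⟨msg, r'', h1, rfl, h2⟩ :=
          (hq ▸ hR q : Represents n q (σ q) (.passive k r' x)).of_passive
        have hh : heard n F r σ q = none := by
          cases hh : heard n F r σ q with
          | none => rfl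
          | some ym =>
            obtain ⟨p', S, e1, -⟩ := received_ordinary H h hR (received_of_heard hh)
            exact absurd e1 (hi _ _)
        rw [settle, if_neg hc, h1, hh]
        by_cases hga : ∃ y, received n F r σ q y = some .goAhead
        · rw [decide_eq_true hga]
          refine ⟨.active x, ?_, fun h3 => absurd h3 hc, (fun h3 => by cases h3),
            Or.inr ⟨_, _, _, rfl, Or.inr ⟨rfl, hga⟩⟩⟩
          simp only [update, if_true, h2]
          exact .active x
        · rw [decide_eq_false hga]
          exact ⟨_, .passive _ _ _ _ h2, fun h3 => absurd h3 hc, (fun h3 => by cases h3),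
            Or.inr ⟨_, _, _, rfl, Or.inl ⟨rfl, not_exists.1 hga⟩⟩⟩
      | active p' => exact absurd hq (hi _ _)
      | retired => exact ⟨_, settle_retired hR hq, fun _ => rfl, fun _ => rfl, Or.inl rfl⟩
  choose a' h1 h2 h3 h4 using key
  have hpas : ∀ {l k r' q}, a' l = .passive k r' q → a l = .passive k r' q ∧
      ∀ y, received n F r σ l y ≠ some .goAhead := by
    intro l k r' q hl
    obtain h5 | ⟨k', r'', x, h5, ⟨h6, h7⟩ | ⟨h6, h7⟩⟩ := h4 l
    · rw [hl] at h5; cases h5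
    · rw [hl] at h6; cases h6
      exact ⟨h5, h7⟩
    · rw [hl] at h6; cases h6
  refine ⟨a', h1, ?_, fun hl => (hpas hl).1⟩
  push_cast
  refine h.activate H (by linarith) le_rfl h3 ?_ ?_ ?_
  · intro l k r' p hl
    have := hA (hpas hl).1
    exact ⟨(hpas hl).1, by linarith⟩
  · intro l j k r' p k' r'' q hl hj hlj hg
    obtain ⟨e1, e2⟩ := hpas hl
    obtain ⟨e3, -⟩ := hpas hj
    have e4 := h.nearPassive e1 e3 hlj hg
    -- In the case of equality `j` polls `l` in this round, and the poll arrives because `j`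
    -- survives; then `l` would not stay passive.
    rcases e4.lt_or_eq with e5 | e5
    · linarith
    · exfalso
      obtain ⟨s1, s2⟩ := h.sender e3
      -- Processes below the last sender are retired and the sender itself is not passive, but `l`
      -- is.
      have hkl : k < l := by
        by_contra hcon
        rcases (not_lt.1 hcon).lt_or_eq with e6 | rfl
        · have := s1 l e6
          rw [e1] at this; cases this
        · exact s2 _ _ _ e1
      obtain ⟨msg, r0, e6, rfl, -⟩ :=
        (e3 ▸ hR j : Represents n j (σ j) (.passive k r' q)).of_passive
      have hop := operation_of_poll H (n := n) msg hkl hlj hg e5.symm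
      rw [← e6] at hop
      have hcj : F.crashRound j ≠ some r := fun e7 => by
        have := h2 j e7
        rw [hj] at this; cases this
      apply e2 j
      unfold received
      rw [hop]
      exact if_pos ⟨Finset.mem_singleton_self l, fun e7 => absurd e7 hcj⟩
  · intro l p hl
    right
    obtain h5 | ⟨k, r', x, h5, ⟨h6, h7⟩ | ⟨h6, y, h7⟩⟩ := h4 l
    · rw [hl] at h5; cases h5
    · rw [hl] at h6; cases h6
    · rw [hl] at h6; cases h6
      obtain ⟨k', r'', p', e1, e2, e3, e4, e5⟩ := received_goAhead H h hR h7
      have := hA h5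
      exact ⟨k, r', h5, by linarith, y, k', r'', p', e1, e3.le, e4, e5⟩

end Round
end ProtocolB

namespace ProtocolB

variable {n t s m : ℕ} {F : FailurePattern t} {a a' : Fin t → View t} {W W' M M' : ℤ}

/-! ### "Go ahead" messages -/

/-- Process `j` has sent `G j` "go ahead" messages, at most one to each member of its group. -/
structure Polls (s m : ℕ) {t : ℕ} (r : ℤ) (a : Fin t → View t) (G : Fin t → ℕ) : Prop where
  le : ∀ j, G j ≤ s
  next : ∀ {j k r' q}, a j = .passive k r' q → ∀ x : Fin t, x ≤ j → grp s x = grp s j → k < x →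
    r ≤ r' - offset s m k + offset s m x → G j ≤ x % s

/-- Polled positions increase strictly, so the count stays at most the position of any member still
to be polled. The last hypothesis says that a new message does not bring back members that were
polled before. -/
theorem Polls.step (H : Params n t s m) {r : ℤ} {G G' : Fin t → ℕ} (h : Polls s m r a G)
    (hG : ∀ j, G' j = G j ∨ (G' j = G j + 1 ∧ ∃ k r' q y, a j = .passive k r' q ∧ k < y ∧ y < j ∧
      grp s y = grp s j ∧ r' - offset s m k + offset s m y = r))
    (hpas : ∀ {j k' r'' q'}, a' j = .passive k' r'' q' → ∃ k r' q, a j = .passive k r' q ∧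
      ∀ x : Fin t, x ≤ j → grp s x = grp s j → k' < x →
        r + 1 ≤ r'' - offset s m k' + offset s m x →
        k < x ∧ r + 1 ≤ r' - offset s m k + offset s m x) :
    Polls s m (r + 1) a' G' := by
  constructor
  · intro j
    obtain h1 | ⟨h1, k, r', q, y, h2, h3, h4, h5, h6⟩ := hG j
    · rw [h1]; exact h.le j
    · rw [h1]
      exact (h.next h2 y h4.le h5 h3 h6.ge).trans_lt (Nat.mod_lt _ H.s_pos)
  · intro j k' r'' q' hj x hx hg hk hr
    obtain ⟨k, r', q, h1, h2⟩ := hpas hj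
    obtain ⟨h3, h4⟩ := h2 x hx hg hk hr
    obtain h5 | ⟨h5, k0, r0, q0, y, e1, e2, e3, e4, e5⟩ := hG j
    · rw [h5]; exact h.next h1 x hx hg h3 (by linarith)
    · rw [h1] at e1
      cases e1
      have h6 := h.next h1 y e3.le e4 e2 e5.ge
      have h7 : (y : ℕ) < x := by
        by_contra hcon
        have := offset_le (m := m) H.s_pos (not_lt.1 hcon)
        linarith
      have h8 := Nat.div_add_mod (x : ℕ) s
      have h9 := Nat.div_add_mod (y : ℕ) s
      have e : (y : ℕ) / s = x / s := Nat.succ_injective (e4.trans hg.symm)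
      rw [e] at h9
      rw [h5]
      generalize (x : ℕ) % s = b at *
      generalize (y : ℕ) % s = c at *
      generalize s * ((x : ℕ) / s) = d at *
      omega

theorem Polls.wake {r : ℤ} {G : Fin t → ℕ} (h : Polls s m r a G) :
    Polls s m r (fun l => wakeView s m r l (a l)) G :=
  ⟨h.le, fun hj => h.next (wakeView_eq_passive hj).1⟩

/-! ### The initial configuration -/

/-- The position in which a process starts if it never receives a message. -/
def initialPos (s l : ℕ) : Pos := if grp s l = 1 then .report 0 1 else .unit 0 0

/-- The view of process `p` before the first round. -/
def initialView (s m : ℕ) {t : ℕ} (F : FailurePattern t) (p : Fin t) : View t :=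
  if F.crashRound p = some 0 then .retired
  else if (p : ℕ) = 0 then .active (.unit 1 m)
  else .passive ⟨0, p.pos⟩ 0 (initialPos s p)

theorem initial_represents (H : Params n t s m) (F : FailurePattern t) (p : Fin t) :
    Represents n p (run n F 0 p) (initialView s m F p) := by
  unfold initialView
  simp only [run]
  split_ifs with h1 h2
  · exact .crashed
  · rw [continueWork_eq H, if_pos H.t_pos]
    exact .active _
  · refine .passive _ _ 0 _ ?_
    have h0 : grp s 0 = 1 := by simp [grp]
    simp only [doWork, H.group_eq, initialPos, h0]
    -- In round 0 the first group hears from its own member, and so starts with a report; the other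
    -- groups start with a partial checkpoint and, since `s ∣ 0`, a full one.
    by_cases h3 : grp s p = 1
    · rw [if_neg (not_not.2 h3.symm), if_pos h3, h3]; rfl
    · rw [if_pos (Ne.symm h3), if_neg h3]
      simp [Pos.code, H.group_eq]

theorem initialView_eq_passive {l k : Fin t} {r' : ℤ} {p : Pos}
    (h : initialView s m F l = .passive k r' p) :
    (k : ℕ) = 0 ∧ r' = 0 ∧ p = initialPos s l ∧ 0 < (l : ℕ) := by
  unfold initialView at h
  split_ifs at h with h1 h2
  cases h
  exact ⟨rfl, rfl, rfl, Nat.pos_of_ne_zero h2⟩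

theorem initialView_eq_active {l : Fin t} {p : Pos} (h : initialView s m F l = .active p) :
    (l : ℕ) = 0 ∧ p = .unit 1 m := by
  unfold initialView at h
  split_ifs at h with h1 h2
  cases h
  exact ⟨h2, rfl⟩

theorem initialPos_start (H : Params n t s m) {k l : Fin t} (hk : (k : ℕ) = 0) (hl : 0 < (l : ℕ)) :
    Start s m k l (initialPos s l) := by
  have h0 : grp s (k : ℕ) = 1 := by simp [grp, hk]
  have h1 := one_le_grp (s := s) l
  unfold initialPos
  split_ifs with h
  · refine ⟨H.t_pos, Or.inr ⟨h0.trans h.symm, ?_, Or.inr ⟨1, rfl, ?_⟩⟩⟩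
    · rw [Fin.lt_def]; omega
    · exact ⟨Nat.zero_le _, dvd_zero s, h.le, H.s_pos⟩
  · exact ⟨H.t_pos, Or.inl ⟨by omega, dvd_zero s, rfl⟩⟩

theorem ceilQuot_zero (hs : 1 ≤ s) : ceilQuot s 0 = 0 := by
  simpa using ceilQuot_mul hs 0

theorem ceilQuot_one (hs : 1 ≤ s) : ceilQuot s 1 = 1 := by
  simpa [ceilQuot_zero hs] using ceilQuot_succ_of_dvd hs (dvd_zero s)

theorem initialPos_label (l : ℕ) : (initialPos s l).label = 0 := by
  unfold initialPos; split_ifs <;> rfl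

theorem initialPos_sends (H : Params n t s m) (l : Fin t) :
    (initialPos s l).sends s t (grp s l) ≤ 1 + t + 2 * (s - 1) * (s + 1) := by
  have h1 := one_le_grp (s := s) l
  have h2 := grp_le H l
  unfold initialPos
  split_ifs with h
  · simp only [Pos.sends, ceilQuot_zero H.s_pos, h]
    push_cast
    linarith
  · simp only [Pos.sends, ceilQuot_zero H.s_pos]
    have : (2 * (s - grp s l) * (s + 1) : ℤ) ≤ 2 * (s - 1) * (s + 1) :=
      mul_le_mul_of_nonneg_right (by omega) (by omega)
    push_cast
    linarith

/-- With `s * s = t`, the bound `s * (1 + t + 2 * (s - 1) * (s + 1))` equals `3 * t * s - s`, whence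
the leading term of `budget`. -/
theorem initialPos_sends_budget (H : Params n t s m) (i l : Fin t) :
    0 + s * (initialPos s l).sends s t (grp s l) ≤ budget t s i := by
  have h1 : (s * (initialPos s l).sends s t (grp s l) : ℤ) ≤ s * (1 + t + 2 * (s - 1) * (s + 1)) :=
    mul_le_mul_of_nonneg_left (initialPos_sends H l) (by omega)
  have h2 : (s * s : ℤ) = t := by exact_mod_cast H.sq
  have h3 : (0 : ℤ) ≤ 3 * t * (grp s i - 1) :=
    mul_nonneg (by omega) (by have := one_le_grp (s := s) i; omega)
  have h4 : (0 : ℤ) ≤ 3 * s * i := by positivity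
  have h5 : (s * (1 + t + 2 * (s - 1) * (s + 1)) : ℤ) = 3 * t * s - s := by
    rw [← h2]; ring
  unfold budget
  linarith

theorem unit_one_sends (H : Params n t s m) :
    (Pos.unit 1 m).sends s t 1 = t + 2 * (s - 1) * s := by
  simp only [Pos.sends, ceilQuot_one H.s_pos]; push_cast; ring

theorem initial_invariant (H : Params n t s m) (F : FailurePattern t) :
    Invariant n s m 1 (initialView s m F) 0 0 := by
  have hs := H.s_pos
  have hm := H.m_pos
  have hst : (s * s : ℤ) = t := by exact_mod_cast H.sq
  have hnt : (n : ℤ) = t * m := by exact_mod_cast H.mul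
  have h0 : grp s 0 = 1 := by simp [grp]
  have hzero : ∀ {l : ℕ} (k : ℕ), k = 0 → 0 < l → grp s l = 1 →
      offset s m k + (m + 2) ≤ offset s m l := by
    rintro l k rfl h1 h2
    exact offset_lt_near (h0.trans h2.symm) h1
  have hsm : (0 : ℤ) ≤ s * m := by positivity
  constructor
  · intro l k r' p hl
    obtain ⟨h1, rfl, rfl, h2⟩ := initialView_eq_passive hl
    refine ⟨initialPos_start H h1 h2, by norm_num, ?_⟩
    have := offset_lt (m := m) hs (show (k : ℕ) < l by omega)
    linarith
  · intro l p hl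
    obtain ⟨h1, rfl⟩ := initialView_eq_active hl
    exact ⟨H.t_pos, le_rfl, by simp⟩
  · intro i p hi l hl
    obtain ⟨h1, rfl⟩ := initialView_eq_active hi
    rw [Fin.lt_def] at hl
    omega
  · intro j k r' p hj
    obtain ⟨h1, rfl, rfl, h2⟩ := initialView_eq_passive hj
    refine ⟨fun l hl => ?_, fun k' r'' p' hk => ?_⟩
    · rw [Fin.lt_def] at hl
      omega
    · have := (initialView_eq_passive hk).2.2.2
      omega
  · rintro l j v p k r' q hl hj hg
    obtain ⟨h1, rfl, rfl, h2⟩ := initialView_eq_passive hj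
    have hgj : ¬ grp s j = 1 := by have := one_le_grp (s := s) l; omega
    have hgj1 : ¬ grp s j ≤ 1 := by omega
    have hjs := grp_le H j
    have hq : (initialPos s j).label = 0 := initialPos_label j
    rw [hq]
    obtain ⟨k', r'', hl, rfl⟩ | ⟨hl, rfl⟩ := hl
    · obtain ⟨h3, rfl, rfl, h4⟩ := initialView_eq_passive hl
      rw [h1, h3]
      unfold groupSlack initialPos
      split_ifs with h5
      · simp only [Pos.nextLabel, Pos.dist, if_pos (show 1 < grp s j by omega)]
        refine ⟨by omega, le_rfl, by omega, ?_, by linarith⟩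
        push_cast
        linarith
      · simp only [Pos.nextLabel, Pos.dist, ceilQuot_zero hs]
        refine ⟨by omega, by omega, by omega, ?_, by linarith⟩
        have := one_le_grp (s := s) l
        push_cast
        linarith
    · obtain ⟨h3, rfl⟩ := initialView_eq_active hl
      rw [h1, h3, h0]
      unfold groupSlack
      simp only [Pos.nextLabel, Pos.dist, ceilQuot_one hs]
      refine ⟨?_, by omega, by omega, ?_, by linarith⟩
      · rw [← H.sq]; exact Nat.mul_le_mul_left s hs
      · have : (1 : ℤ) ≤ s := by exact_mod_cast hs
        push_cast
        linarith
  · intro l j k r' p k' r'' q hl hj hlj hg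
    obtain ⟨h1, rfl, rfl, h2⟩ := initialView_eq_passive hj
    obtain ⟨-, -, -, h3⟩ := initialView_eq_passive hl
    have := offset_lt (m := m) hs (show (k : ℕ) < l by omega)
    linarith
  · intro l j p k r' q hl hj hlj hg
    obtain ⟨h1, rfl, rfl, h2⟩ := initialView_eq_passive hj
    obtain ⟨h3, rfl⟩ := initialView_eq_active hl
    have hq : (initialPos s j).label = 0 := initialPos_label j
    refine ⟨?_, ?_⟩
    · simp only [Pos.near]; rw [h1, h3]; linarith
    · obtain ⟨m', rfl⟩ : ∃ m', m = m' + 1 := ⟨m - 1, by omega⟩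
      exact ⟨Fin.ext (h1.trans h3.symm), by rw [hq]⟩
  · rintro l v p hl
    have h2 : (0 : ℤ) ≤ m * l := by positivity
    have h3 : (0 : ℤ) ≤ (grp s l - 1) * (s * m) :=
      mul_nonneg (by have := one_le_grp (s := s) l; omega) hsm
    have h4 : p.works m t = t * m := by
      obtain ⟨k', r'', hl, rfl⟩ | ⟨hl, rfl⟩ := hl
      · obtain ⟨-, -, rfl, -⟩ := initialView_eq_passive hl
        unfold initialPos
        split_ifs <;> simp [Pos.works]
      · obtain ⟨-, rfl⟩ := initialView_eq_active hl
        simp only [Pos.works]; push_cast; ring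
    linarith
  · positivity
  · intro i p hi
    obtain ⟨h1, rfl⟩ := initialView_eq_active hi
    rw [h1, h0, unit_one_sends H]
    unfold budget
    rw [h0, ← hst]
    push_cast
    nlinarith [mul_nonneg (Int.natCast_nonneg s) (Int.natCast_nonneg s)]
  · intro i l p k r' q hi hl hil hg
    obtain ⟨h1, rfl, rfl, h2⟩ := initialView_eq_passive hl
    have := initialPos_sends_budget H i l
    have := extra_nonneg (s := s) p
    linarith
  · intro i l k r' p k' r'' q hi hl hil hg
    obtain ⟨h1, rfl, rfl, h2⟩ := initialView_eq_passive hl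
    exact initialPos_sends_budget H i l
  · positivity
  · rintro l v p hl
    have hts : (1 : ℤ) ≤ s := by exact_mod_cast hs
    unfold horizon
    obtain ⟨k', r'', hl, rfl⟩ | ⟨hl, rfl⟩ := hl
    · obtain ⟨h1, rfl, rfl, h2⟩ := initialView_eq_passive hl
      have h3 : (initialPos s l).works m t = t * m := by
        unfold initialPos
        split_ifs <;> simp [Pos.works]
      have := initialPos_sends H l
      rw [h1, h3]
      linarith
    · obtain ⟨h1, rfl⟩ := initialView_eq_active hl
      rw [h1, h0, unit_one_sends H]
      simp only [Pos.works]
      push_cast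
      linarith

theorem initial_polls (F : FailurePattern t) :
    Polls s m 1 (initialView s m F) fun _ => 0 :=
  ⟨fun _ => Nat.zero_le _, fun _ _ _ _ _ _ => Nat.zero_le _⟩

/-! ### Executions -/

/-- The number of ordinary messages sent in rounds `1, …, R`. -/
def totalOrdinaries (n : ℕ) {t : ℕ} (F : FailurePattern t) (R : ℕ) : ℕ :=
  ∑ r ∈ Finset.Icc 1 R, ∑ p, Op.ordinaries (operation n r p (stateIn n F r p))

/-- The number of "go ahead" messages sent by process `p` in rounds `1, …, R`. -/
def goAheadsBy (n : ℕ) {t : ℕ} (F : FailurePattern t) (R : ℕ) (p : Fin t) : ℕ :=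
  ∑ r ∈ Finset.Icc 1 R, Op.goAheads (operation n r p (stateIn n F r p))

theorem totalMessages_eq (n : ℕ) (F : FailurePattern t) (R : ℕ) :
    totalMessages n F R = totalOrdinaries n F R + ∑ p, goAheadsBy n F R p := by
  unfold totalMessages totalOrdinaries goAheadsBy
  rw [Finset.sum_comm (s := Finset.univ), ← Finset.sum_add_distrib]
  refine Finset.sum_congr rfl fun r _ => ?_
  rw [← Finset.sum_add_distrib]
  exact Finset.sum_congr rfl fun p _ => messagesIn_eq n F r p

/-! ### Counting the operations of one round -/

section Round

variable {r : ℕ} {σ : Fin t → State t}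

/-- Only active processes work and send ordinary messages. -/
theorem counts_of_not_active (H : Params n t s m) (h : Invariant n s m r a W M)
    (hR : ∀ l, Represents n l (σ l) (a l)) {x : Fin t} (hx : ∀ p, a x ≠ .active p) :
    Op.works (operation n r x (σ x)) = 0 ∧ Op.ordinaries (operation n r x (σ x)) = 0 := by
  cases ho : operation n r x (σ x) with
  | none => exact ⟨rfl, rfl⟩
  | some o =>
    obtain ⟨p, hp, -⟩ | ⟨_, _, _, _, -, -, -, -, -, rfl⟩ := operation_cases H h hR ho
    · exact absurd hp (hx p)
    · exact ⟨rfl, rfl⟩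

theorem counts_of_active (H : Params n t s m) (h : Invariant n s m r a W M)
    (hR : ∀ l, Represents n l (σ l) (a l)) {i : Fin t} {p : Pos} (hi : a i = .active p) :
    (∑ x, Op.works (operation n r x (σ x)) = Op.works (some (p.op n i))) ∧
      ∑ x, Op.ordinaries (operation n r x (σ x)) = Op.ordinaries (some (p.op n i)) := by
  have h1 : ∀ x, x ≠ i → ∀ p, a x ≠ .active p := fun x hx p hp =>
    hx (active_unique h hp hi)
  rw [Finset.sum_eq_single i (fun x _ hx => (counts_of_not_active H h hR (h1 x hx)).1) (by simp),
    Finset.sum_eq_single i (fun x _ hx => (counts_of_not_active H h hR (h1 x hx)).2) (by simp),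
    operation_active H h hR hi]
  exact ⟨rfl, rfl⟩

theorem goAheads_cases (H : Params n t s m) (h : Invariant n s m r a W M)
    (hR : ∀ l, Represents n l (σ l) (a l)) (x : Fin t) :
    Op.goAheads (operation n r x (σ x)) = 0 ∨ (Op.goAheads (operation n r x (σ x)) = 1 ∧
      ∃ k r' q y, a x = .passive k r' q ∧ k < y ∧ y < x ∧
      grp s y = grp s x ∧ r' - offset s m k + offset s m y = r) := by
  cases ho : operation n r x (σ x) with
  | none => exact Or.inl rfl
  | some o =>
    obtain ⟨p, hp, rfl⟩ | ⟨k, r', q, y, e1, e2, e3, e4, e5, rfl⟩ := operation_cases H h hR ho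
    · left
      obtain ⟨-, u, h4⟩ | ⟨-, msg, S, h4, -⟩ := op_cases (n := n) H x p <;> rw [h4] <;> rfl
    · exact Or.inr ⟨Finset.card_singleton y, k, r', q, y, e1, e2, e3, e4, e5⟩

/-- A new message comes from the active process, which is not below the previous sender, and nobody
above the active process has been polled yet. -/
theorem ActiveRound.polls_hyp (H : Params n t s m) {r : ℤ} (h : Invariant n s m r a W M)
    {i : Fin t} {p : Pos} (A : ActiveRound s m r a a' i p W W' M M') {j k' : Fin t} {r'' : ℤ}
    {q' : Pos} (hj : a' j = .passive k' r'' q') :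
    ∃ k r' q, a j = .passive k r' q ∧
      ∀ x : Fin t, x ≤ j → grp s x = grp s j → k' < x →
        r + 1 ≤ r'' - offset s m k' + offset s m x →
        k < x ∧ r + 1 ≤ r' - offset s m k + offset s m x := by
  obtain ⟨hij, ⟨h1, -⟩ | ⟨rfl, rfl, rfl, -, -, k0, r0, x0, h1⟩⟩ := A.passive_cases h hj
  · exact ⟨_, _, _, h1, fun x _ _ hk hr => ⟨hk, hr⟩⟩
  · exact ⟨_, _, _, h1, fun x hx hg hk _ =>
      ⟨(A.sender_le h h1).trans_lt hk, A.not_polled H h h1 hx hg hk⟩⟩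

end Round

/-- What holds at the end of round `R`. -/
def Snapshot (n s m : ℕ) {t : ℕ} (F : FailurePattern t) (R : ℕ) (σ : Fin t → State t)
    (a : Fin t → View t) : Prop :=
  (∀ l, Represents n l (σ l) (a l)) ∧
    Invariant n s m (R + 1 : ℕ) a (totalWork n F R) (totalOrdinaries n F R) ∧
    Polls s m (R + 1 : ℕ) a (goAheadsBy n F R)

theorem Snapshot.wake (H : Params n t s m) {R : ℕ} (h : Snapshot n s m F R (run n F R) a) :
    Snapshot n s m F R (stateIn n F (R + 1)) (fun l => wakeView s m (R + 1 : ℕ) l (a l)) ∧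
      Awake s m (R + 1 : ℕ) fun l => wakeView s m (R + 1 : ℕ) l (a l) := by
  obtain ⟨h1, h2, h3⟩ := h
  obtain ⟨h4, h5⟩ := h2.wake H
  exact ⟨⟨fun l => (h1 l).wake H fun hl => (h2.passive hl).1.lt, h4, h3.wake⟩, h5⟩

theorem Snapshot.next (H : Params n t s m) {R : ℕ}
    (h : Snapshot n s m F R (stateIn n F (R + 1)) a) (hA : Awake s m (R + 1 : ℕ) a) :
    ∃ a', Snapshot n s m F (R + 1) (run n F (R + 1)) a' := by
  obtain ⟨hR, hI, hP⟩ := h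
  have hrun : run n F (R + 1) = settle n F (R + 1) (stateIn n F (R + 1)) := rfl
  have hW : totalWork n F (R + 1) = totalWork n F R +
      ∑ x, Op.works (operation n (R + 1) x (stateIn n F (R + 1) x)) := by
    unfold totalWork
    rw [Finset.sum_Icc_succ_top (by omega)]
    simp only [workIn_eq]
  have hM : totalOrdinaries n F (R + 1) = totalOrdinaries n F R +
      ∑ x, Op.ordinaries (operation n (R + 1) x (stateIn n F (R + 1) x)) := by
    unfold totalOrdinaries
    rw [Finset.sum_Icc_succ_top (by omega)]
  have hG : ∀ j, goAheadsBy n F (R + 1) j = goAheadsBy n F R j ∨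
      (goAheadsBy n F (R + 1) j = goAheadsBy n F R j + 1 ∧
      ∃ k r' q y, a j = .passive k r' q ∧ k < y ∧ y < j ∧
      grp s y = grp s j ∧ r' - offset s m k + offset s m y = (R + 1 : ℕ)) := by
    intro j
    unfold goAheadsBy
    rw [Finset.sum_Icc_succ_top (by omega)]
    obtain h1 | ⟨h1, h2⟩ := goAheads_cases H hI hR j
    · rw [h1]; exact Or.inl rfl
    · rw [h1]; exact Or.inr ⟨rfl, h2⟩
  by_cases hi : ∃ i p, a i = .active p
  · obtain ⟨i, p, hi⟩ := hi
    obtain ⟨c1, c2⟩ := counts_of_active H hI hR hi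
    obtain ⟨a', h1, A⟩ := exists_activeRound (F := F) H hI hR hA hi
      (W' := totalWork n F (R + 1)) (M' := totalOrdinaries n F (R + 1)) (by
        rw [hW, hM, c1, c2]
        obtain ⟨h1, u, h2⟩ | ⟨h1, msg, S, h2, h3, -⟩ := op_cases (n := n) H i p <;> rw [h2]
        · exact Or.inl ⟨h1, by simp [Op.works], by simp [Op.ordinaries]⟩
        · exact Or.inr ⟨h1, by simp [Op.works], by simp, by simp [Op.ordinaries, h3]⟩)
    refine ⟨a', hrun ▸ h1, ?_, ?_⟩
    · rw [Nat.cast_succ (R + 1)]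
      exact A.invariant H hI
    · rw [Nat.cast_succ (R + 1)]
      exact hP.step H hG (A.polls_hyp H hI)
  · have hi' : ∀ i p, a i ≠ .active p := fun i p h => hi ⟨i, p, h⟩
    obtain ⟨a', h1, h2, h3⟩ := exists_quietRound (F := F) H hI hR hA hi'
    have c := fun x => counts_of_not_active H hI hR (hi' x)
    refine ⟨a', hrun ▸ h1, ?_, ?_⟩
    · rw [hW, hM, Finset.sum_eq_zero fun x _ => (c x).1, Finset.sum_eq_zero fun x _ => (c x).2]
      exact h2
    · rw [Nat.cast_succ (R + 1)]
      exact hP.step H hG fun hj => ⟨_, _, _, h3 hj, fun x _ _ hk hr => ⟨hk, hr⟩⟩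

theorem exists_snapshot (H : Params n t s m) (F : FailurePattern t) (R : ℕ) :
    ∃ a, Snapshot n s m F R (run n F R) a := by
  induction R with
  | zero =>
    have h : goAheadsBy n F 0 = fun _ => 0 := by funext; simp [goAheadsBy]
    exact ⟨_, initial_represents H F,
      by simpa [totalWork, totalOrdinaries] using initial_invariant H F,
      by simpa [h] using initial_polls F⟩
  | succ R ih =>
    obtain ⟨a, h⟩ := ih
    obtain ⟨h1, h2⟩ := h.wake H
    exact h1.next H h2

/-! ### The bounds -/

theorem totalMessages_le (H : Params n t s m) (F : FailurePattern t) (R : ℕ) :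
    totalMessages n F R ≤ 10 * t * s := by
  obtain ⟨a, -, h1, h2⟩ := exists_snapshot H F R
  have h3 : totalOrdinaries n F R ≤ 9 * (t * s) := by exact_mod_cast h1.msg_le
  have h4 : ∑ p, goAheadsBy n F R p ≤ t * s := by
    simpa using Finset.sum_le_card_nsmul Finset.univ _ s fun p _ => h2.le p
  rw [totalMessages_eq]
  calc _ ≤ 9 * (t * s) + t * s := Nat.add_le_add h3 h4
    _ = 10 * t * s := by ring

theorem horizon_add_offset (H : Params n t s m) (l : Fin t) :
    horizon t s m + offset s m l ≤ 3 * n + 8 * t := by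
  have h1 : ((l : ℕ) % s : ℕ) + 1 ≤ s := Nat.mod_lt _ H.s_pos
  have h2 : (grp s l * (groupSlack s m + 1 + (s - 1) * (m + 2)) : ℤ) ≤
      s * (groupSlack s m + 1 + (s - 1) * (m + 2)) := by
    refine mul_le_mul_of_nonneg_right (by exact_mod_cast grp_le H l) ?_
    have : (0 : ℤ) ≤ (s - 1) * (m + 2) := mul_nonneg (by omega) (by omega)
    unfold groupSlack
    positivity
  have h3 : (((l : ℕ) % s : ℕ) * (m + 2) : ℤ) ≤ (s - 1) * (m + 2) :=
    mul_le_mul_of_nonneg_right (by omega) (by omega)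
  have h4 : (s * s : ℤ) = t := by exact_mod_cast H.sq
  have h5 : (n : ℤ) = t * m := by exact_mod_cast H.mul
  have h6 : offset s m 0 = groupSlack s m + 1 + (s - 1) * (m + 2) := by simp [offset, grp]
  have h7 : (0 : ℤ) ≤ s * m := by positivity
  unfold horizon
  rw [h6]
  unfold offset
  unfold groupSlack at *
  rw [h5, ← h4] at *
  -- With the extreme values of group and position inserted, the left side is 3n + 8t − 2sm − 4s −
  -- 2.
  nlinarith

/-- A live process has at least one broadcast left, so the clause `time` keeps the coming round
below `horizon + offset`. -/
theorem retired_at_end (H : Params n t s m) (F : FailurePattern t) (p : Fin t) :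
    (run n F (3 * n + 8 * t) p).Retired := by
  obtain ⟨a, h1, h2, -⟩ := exists_snapshot H F (3 * n + 8 * t)
  have h3 := horizon_add_offset H p
  refine (h1 p).retired ?_
  cases hp : a p with
  | passive k r' q =>
    exfalso
    obtain ⟨h4, -, h5⟩ := h2.passive hp
    have h6 := h2.time (Or.inl ⟨k, r', hp, rfl⟩)
    have h7 := Pos.works_nonneg h4.valid
    have h8 := Pos.sends_pos H (grp_le H p) h4.valid
    push_cast at h5
    linarith
  | active q =>
    exfalso
    have h6 := h2.time (Or.inr ⟨hp, rfl⟩)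
    have h7 := Pos.works_nonneg (h2.active hp)
    have h8 := Pos.sends_pos H (grp_le H p) (h2.active hp)
    push_cast at h6
    linarith
  | retired => rfl

end ProtocolB

theorem theorem2p8 (n t : ℕ) (hn : 0 < n) (ht : IsSquare t) (htn : t ∣ n)
    (F : ProtocolB.FailurePattern t) :
    (∀ R : ℕ, ProtocolB.totalWork n F R ≤ 3 * n) ∧
    (∀ R : ℕ, (ProtocolB.totalMessages n F R : ℝ) ≤ 10 * t * Real.sqrt t) ∧
    (∀ p : Fin t, (ProtocolB.run n F (3 * n + 8 * t) p).Retired) ∧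
    (∀ r : ℕ, 1 ≤ r → ∀ i : Fin t, (ProtocolB.stateIn n F r i).IsActive →
      ∀ l : Fin t, l < i → (ProtocolB.run n F (r - 1) l).Retired) := by
  obtain ⟨s, rfl⟩ := ht
  obtain ⟨m, rfl⟩ := htn
  have H : ProtocolB.Params (s * s * m) (s * s) s m :=
    ⟨rfl, rfl, Nat.pos_of_ne_zero (by rintro rfl; simp at hn),
      Nat.pos_of_ne_zero (by rintro rfl; simp at hn)⟩
  refine ⟨fun R => ?_, fun R => ?_, ProtocolB.retired_at_end H F, fun r hr i hi l hl => ?_⟩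
  · obtain ⟨a, -, h, -⟩ := ProtocolB.exists_snapshot H F R
    exact_mod_cast h.work_le
  · have h : Real.sqrt ((s * s : ℕ) : ℝ) = s := by
      rw [Nat.cast_mul, Real.sqrt_mul_self (Nat.cast_nonneg s)]
    rw [h]
    exact_mod_cast ProtocolB.totalMessages_le H F R
  · obtain ⟨R, rfl⟩ : ∃ R, r = R + 1 := ⟨r - 1, by omega⟩
    obtain ⟨a, h⟩ := ProtocolB.exists_snapshot H F R
    obtain ⟨⟨h1, h2, -⟩, -⟩ := h.wake H
    obtain ⟨p, hp⟩ := (h1 i).exists_active hi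
    -- A time-out retires nobody, so a process that is retired during the round was retired at the
    -- end of the previous one.
    exact (h.1 l).retired (ProtocolB.wakeView_eq_retired (h2.low hp l hl))
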